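/- Let $\Gamma$ be a countable discrete group. A trace on $\Gamma$ is a positive definite, conjugation-invariant function $\varphi:\Gamma\to\mathbb{C}$ with $\varphi(e)=1$. The convex set $\mathrm{Tr}(\Gamma)$ of traces carries the topology of pointwise convergence, and its extreme points are called characters; their set is denoted $\mathrm{Ch}(\Gamma)$. For a trace $\varphi$ let $\pi_\varphi$ be its GNS representation, i.e. the unitary representation (unique up to equivalence) with a cyclic vector $v_\varphi$ such that $\varphi(\gamma)=\langle\pi_\varphi(\gamma)v_\varphi,v_\varphi\rangle$ for all $\gamma\in\Gamma$. The trace $\varphi$ is finite-dimensional if $\pi_\varphi$ is. A set $\mathcal{R}$ of equivalence classes of unitary representations of $\Gamma$ is hereditary if it is closed under passing to subrepresentations and to dual representations, and if for every unitary representation $\Pi$ of $\Gamma\times\Gamma$ whose restrictions to both factors belong to $\mathcal{R}$, the restriction of $\Pi$ to the diagonal copy of $\Gamma$ belongs to $\mathcal{R}$. For a unitary representation $\pi$ let $\pi_0$ be its subrepresentation on the orthogonal complement of the invariant vectors. The group $\Gamma$ has property $\mathrm{T}(\mathcal{R})$ if the trivial one-dimensional representation $1$ is an isolated point of the set $\{\pi_0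 : \pi\in\mathcal{R}\}\cup\{1\}$ in the Fell topology. Put $\mathrm{Ch}(\Gamma;\mathcal{R})=\{\varphi\in\mathrm{Ch}(\Gamma) : \pi_\varphi\in\mathcal{R}\}$, and let $\overline{\mathrm{Ch}(\Gamma;\mathcal{R})}$ be its closure for pointwise convergence. Proposition. (1) Let $\mathcal{R}$ be a hereditary set of equivalence classes of unitary representations of $\Gamma$, and assume that $\Gamma$ has property $\mathrm{T}(\mathcal{R})$. Then every finite-dimensional character $\varphi\in\overline{\mathrm{Ch}(\Gamma;\mathcal{R})}$ is an isolated point of $\overline{\mathrm{Ch}(\Gamma;\mathcal{R})}$. (2) In particular, if $\Gamma$ has Kazhdan's property (T), then every finite-dimensional character of $\Gamma$ is an isolated point of $\mathrm{Ch}(\Gamma)$. -/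

import Mathlib

open scoped ComplexOrder ComplexConjugate Topology

universe u

noncomputable section

/-! ### Unitary representations -/

/-- A unitary representation of the (discrete) group `Γ` on a complex Hilbert space. -/
structure UnitaryRep (Γ : Type u) [Group Γ] where
  /-- the underlying Hilbert space -/
  H : Type u
  [instNormed : NormedAddCommGroup H]
  [instInner : InnerProductSpace ℂ H]
  [instComplete : CompleteSpace H]
  /-- the action by unitary operators -/
  act : Γ →* (H ≃ₗᵢ[ℂ] H)

attribute [instance] UnitaryRep.instNormed UnitaryRep.instInner UnitaryRep.instComplete

namespace UnitaryRep

variable {Γ : Type u} [Group Γ]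

/-- `σ ≤ π`: the representation `σ` is (unitarily equivalent to) a subrepresentation of `π`, that
is, there is a linear isometry of `σ.H` into `π.H` intertwining the two actions. -/
def IsSubrep (σ π : UnitaryRep Γ) : Prop :=
  ∃ V : σ.H →ₗᵢ[ℂ] π.H, ∀ (γ : Γ) (x : σ.H), V (σ.act γ x) = π.act γ (V x)

/-- Unitary equivalence of representations. -/
def Equivalent (σ π : UnitaryRep Γ) : Prop :=
  ∃ U : σ.H ≃ₗᵢ[ℂ] π.H, ∀ (γ : Γ) (x : σ.H), U (σ.act γ x) = π.act γ (U x)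

/-- The trivial representation `1` of `Γ` on the one-dimensional Hilbert space. -/
def trivial (Γ : Type u) [Group Γ] : UnitaryRep Γ where
  H := EuclideanSpace ℂ PUnit.{u + 1}
  act := 1

/-- The pull-back of a representation along a group homomorphism. -/
def comap {Λ : Type u} [Group Λ] (f : Λ →* Γ) (π : UnitaryRep Γ) : UnitaryRep Λ where
  H := π.H
  act := π.act.comp f

/-- The subspace of invariant vectors. -/
def invariants (π : UnitaryRep Γ) : Submodule ℂ π.H where
  carrier := {x | ∀ γ, π.act γ x = x}
  add_mem' hx hy γ := by rw [map_add, hx γ, hy γ]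
  zero_mem' γ := map_zero _
  smul_mem' c x hx γ := by rw [map_smul, hx γ]

theorem act_inv_act (π : UnitaryRep Γ) (γ : Γ) (x : π.H) : π.act γ⁻¹ (π.act γ x) = x := by
  change (π.act γ⁻¹ * π.act γ) x = x
  rw [← map_mul, inv_mul_cancel, map_one]; rfl

theorem act_act_inv (π : UnitaryRep Γ) (γ : Γ) (x : π.H) : π.act γ (π.act γ⁻¹ x) = x := by
  change (π.act γ * π.act γ⁻¹) x = x
  rw [← map_mul, mul_inv_cancel, map_one]; rfl

theorem act_mem_invariants_orthogonal (π : UnitaryRep Γ) (γ : Γ) {x : π.H}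
    (hx : x ∈ π.invariantsᗮ) : π.act γ x ∈ π.invariantsᗮ := by
  rw [Submodule.mem_orthogonal] at hx ⊢
  intro y hy
  rw [← hy γ, LinearIsometryEquiv.inner_map_map]
  exact hx y hy

/-- The subrepresentation `π₀` of `π` on the orthogonal complement of the invariant vectors. -/
def nontrivialPart (π : UnitaryRep Γ) : UnitaryRep Γ where
  H := π.invariantsᗮ
  act :=
    { toFun := fun γ =>
        { toFun := fun x => ⟨π.act γ x, π.act_mem_invariants_orthogonal γ x.2⟩
          map_add' := fun x y => Subtype.ext (map_add (π.act γ) (x : π.H) y)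
          map_smul' := fun c x => Subtype.ext (map_smul (π.act γ) c (x : π.H))
          invFun := fun x => ⟨π.act γ⁻¹ x, π.act_mem_invariants_orthogonal γ⁻¹ x.2⟩
          left_inv := fun x => Subtype.ext (π.act_inv_act γ x)
          right_inv := fun x => Subtype.ext (π.act_act_inv γ x)
          norm_map' := fun x => (π.act γ).norm_map (x : π.H) }
      map_one' := by
        ext x
        change π.act 1 (x : π.H) = x
        rw [map_one]; rfl
      map_mul' := fun γ δ => by
        ext x
        change π.act (γ * δ) (x : π.H) = π.act γ (π.act δ x)
        rw [map_mul]; rfl }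

/-- The Hilbert space structure on the dual of a Hilbert space:
`⟪f, g⟫ = ⟪v_g, v_f⟫`, where `f = ⟪v_f, ·⟫` and `g = ⟪v_g, ·⟫`. -/
@[reducible]
def dualInner (E : Type u) [NormedAddCommGroup E] [InnerProductSpace ℂ E] [CompleteSpace E] :
    InnerProductSpace ℂ (StrongDual ℂ E) where
  inner f g := inner ℂ ((InnerProductSpace.toDual ℂ E).symm g)
    ((InnerProductSpace.toDual ℂ E).symm f)
  norm_sq_eq_re_inner f := by
    rw [← (InnerProductSpace.toDual ℂ E).symm.norm_map f]
    exact (inner_self_eq_norm_sq _).symm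
  conj_inner_symm f g := inner_conj_symm _ _
  add_left f g h := by rw [map_add, inner_add_right]
  smul_left f g c := by rw [map_smulₛₗ, inner_smul_right]

/-- The dual (contragredient) representation `π*` on the dual Hilbert space:
`(π*(γ) f)(x) = f (π(γ)⁻¹ x)`. -/
def dual (π : UnitaryRep Γ) : UnitaryRep Γ :=
  letI : InnerProductSpace ℂ (StrongDual ℂ π.H) := dualInner π.H
  { H := StrongDual ℂ π.H
    act :=
      { toFun := fun γ =>
          { toFun := fun f => f.comp (π.act γ⁻¹ : π.H →L[ℂ] π.H)
            map_add' := fun f g => rfl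
            map_smul' := fun c f => rfl
            invFun := fun f => f.comp (π.act γ : π.H →L[ℂ] π.H)
            left_inv := fun f => by
              ext x
              change f (π.act γ⁻¹ (π.act γ x)) = f x
              rw [π.act_inv_act]
            right_inv := fun f => by
              ext x
              change f (π.act γ (π.act γ⁻¹ x)) = f x
              rw [π.act_act_inv]
            norm_map' := fun f => ContinuousLinearMap.opNorm_comp_linearIsometryEquiv f _ }
        map_one' := by
          ext f x
          change f (π.act 1⁻¹ x) = f x
          rw [inv_one, map_one]; rfl
        map_mul' := fun γ δ => by
          ext f x
          change f (π.act (γ * δ)⁻¹ x) = f (π.act δ⁻¹ (π.act γ⁻¹ x))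
          rw [mul_inv_rev, map_mul]; rfl } }

/-! ### The Fell topology -/

/-- The function of positive type `γ ↦ ⟨π(γ)ξ, ξ⟩` associated to the representation `π` and the
vector `ξ`. (Mathlib's inner product is linear in the second variable.) -/
def coeff (π : UnitaryRep Γ) (ξ : π.H) (γ : Γ) : ℂ := inner ℂ ξ (π.act γ ξ)

/-- The basic set `W(π, φ₁, …, φₙ, Q, ε)` of the Fell topology, where `φᵢ` is the function of
positive type associated to `π` and `ξ i`: the set of all representations `ρ` such that every `φᵢ`
is `ε`-close on the finite set `Q` to a sum of functions of positive type associated to `ρ`. -/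
def fellNhd (π : UnitaryRep Γ) {n : ℕ} (ξ : Fin n → π.H) (Q : Finset Γ) (ε : ℝ) :
    Set (UnitaryRep Γ) :=
  {ρ | ∀ i, ∃ (m : ℕ) (η : Fin m → ρ.H),
    ∀ γ ∈ Q, ‖π.coeff (ξ i) γ - ∑ j, ρ.coeff (η j) γ‖ < ε}

/-- The Fell topology on unitary representations (equivalent representations are topologically
indistinguishable, so this is the same as a topology on equivalence classes). -/
instance fellTopology (Γ : Type u) [Group Γ] : TopologicalSpace (UnitaryRep Γ) :=
  TopologicalSpace.generateFrom
    {W | ∃ (π : UnitaryRep Γ) (n : ℕ) (ξ : Fin n → π.H) (Q : Finset Γ) (ε : ℝ),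
      0 < ε ∧ W = fellNhd π ξ Q ε}

end UnitaryRep

/-- `x` is an isolated point of the subset `S`: it belongs to `S` and `{x}` is open in `S`. -/
def IsIsolatedPointOf {X : Type*} [TopologicalSpace X] (x : X) (S : Set X) : Prop :=
  ∃ U : Set X, IsOpen U ∧ U ∩ S = {x}

section Families

variable {Γ : Type u} [Group Γ]

/-- Property `T(R)`: the trivial representation is isolated, for the Fell topology, in
`{π₀ : π ∈ R} ∪ {1}`. -/
def HasPropertyTRel (R : Set (UnitaryRep Γ)) : Prop :=
  IsIsolatedPointOf (UnitaryRep.trivial Γ)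
    (UnitaryRep.nontrivialPart '' R ∪ {UnitaryRep.trivial Γ})

/-- Kazhdan's property (T): there is a Kazhdan pair `(Q, ε)`, that is, every unitary representation
with a `(Q, ε)`-invariant vector has a non-zero invariant vector. -/
def HasPropertyT (Γ : Type u) [Group Γ] : Prop :=
  ∃ (Q : Finset Γ) (ε : ℝ), 0 < ε ∧ ∀ π : UnitaryRep Γ,
    (∃ ξ : π.H, ξ ≠ 0 ∧ ∀ γ ∈ Q, ‖π.act γ ξ - ξ‖ < ε * ‖ξ‖) →
      ∃ η : π.H, η ≠ 0 ∧ ∀ γ, π.act γ η = η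

/-- Hereditary families of unitary representations. The first condition contains the invariance of
the family under unitary equivalence, so that it amounts to a set of equivalence classes. -/
structure IsHereditary (R : Set (UnitaryRep Γ)) : Prop where
  subrep_closed : ∀ ρ ∈ R, ∀ π : UnitaryRep Γ, π.IsSubrep ρ → π ∈ R
  dual_closed : ∀ ρ ∈ R, ρ.dual ∈ R
  /-- If the restrictions of a representation of `Γ × Γ` to both factors are in `R`, then so is its
  restriction to the diagonal. -/
  diagonal_closed : ∀ P : UnitaryRep (Γ × Γ),
    P.comap (MonoidHom.inl Γ Γ) ∈ R → P.comap (MonoidHom.inr Γ Γ) ∈ R →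
      P.comap ((MonoidHom.id Γ).prod (MonoidHom.id Γ)) ∈ R

theorem IsHereditary.mem_of_equivalent {R : Set (UnitaryRep Γ)} (hR : IsHereditary R)
    {π ρ : UnitaryRep Γ} (h : π.Equivalent ρ) (hρ : ρ ∈ R) : π ∈ R := by
  obtain ⟨U, hU⟩ := h
  exact hR.subrep_closed ρ hρ π ⟨U.toLinearIsometry, hU⟩

end Families

/-! ### Traces and characters -/

section Traces

variable {Γ : Type u} [Group Γ]

/-- Positive definite functions on a group. (`0 ≤ z` for a complex number `z` means that `z` is real
and nonnegative.) -/
def IsPosDefFun (φ : Γ → ℂ) : Prop :=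
  ∀ (n : ℕ) (γ : Fin n → Γ) (α : Fin n → ℂ),
    0 ≤ ∑ i, ∑ j, α i * conj (α j) * φ ((γ j)⁻¹ * γ i)

variable (Γ) in
/-- The space `Tr(Γ)` of traces, as a subset of the space `Γ → ℂ` with the topology of pointwise
convergence. -/
def traceSet : Set (Γ → ℂ) :=
  {φ | IsPosDefFun φ ∧ (∀ x γ : Γ, φ (x⁻¹ * γ * x) = φ γ) ∧ φ 1 = 1}

variable (Γ) in
/-- The set `Ch(Γ)` of characters: the extreme points of `Tr(Γ)`. -/
def charSet : Set (Γ → ℂ) := Set.extremePoints ℝ (traceSet Γ)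

theorem charSet_subset : charSet Γ ⊆ traceSet Γ := extremePoints_subset

/-! ### The GNS representation of a trace -/

theorem IsPosDefFun.map_inv {φ : Γ → ℂ} (h : IsPosDefFun φ) (g : Γ) : φ g⁻¹ = conj (φ g) := by
  have h0 := h 1 ![1] ![1]
  have h1 := h 2 ![1, g] ![1, 1]
  have h2 := h 2 ![1, g] ![1, Complex.I]
  simp [Fin.sum_univ_two, Complex.le_def] at h0 h1 h2
  apply Complex.ext
  · simp; linarith [h0.2, h1.2, h2.2]
  · simp; linarith [h0.2, h1.2, h2.2]

theorem IsPosDefFun.sum_nonneg {φ : Γ → ℂ} (h : IsPosDefFun φ) (f : Γ →₀ ℂ) :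
    0 ≤ f.sum fun a z => f.sum fun b w => conj z * w * φ (a⁻¹ * b) := by
  let e := f.support.equivFin
  have := h f.support.card (fun i => (e.symm i : Γ)) (fun i => f (e.symm i))
  refine this.trans_eq ?_
  rw [Finset.sum_comm, Finsupp.sum, ← Finset.sum_coe_sort f.support, ← e.symm.sum_comp]
  refine Finset.sum_congr rfl fun j _ => ?_
  rw [Finsupp.sum, ← Finset.sum_coe_sort f.support, ← e.symm.sum_comp]
  refine Finset.sum_congr rfl fun i _ => ?_
  ring

set_option linter.unusedVariables false in
/-- The space `ℂ[Γ]`, to be equipped with the semi-inner product given by the trace `φ`. -/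
def PreGNS (φ : Γ → ℂ) (hφ : φ ∈ traceSet Γ) : Type u := Γ →₀ ℂ

namespace PreGNS

variable (φ : Γ → ℂ) (hφ : φ ∈ traceSet Γ)

instance : AddCommGroup (PreGNS φ hφ) := inferInstanceAs (AddCommGroup (Γ →₀ ℂ))

instance : Module ℂ (PreGNS φ hφ) := inferInstanceAs (Module ℂ (Γ →₀ ℂ))

/-- The identity map from `ℂ[Γ]`. -/
def of : (Γ →₀ ℂ) ≃ₗ[ℂ] PreGNS φ hφ := LinearEquiv.refl ℂ _

/-- The semi-inner product with `⟪δ_a, δ_b⟫ = φ (a⁻¹ b)`. -/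
@[reducible]
def core : PreInnerProductSpace.Core ℂ (PreGNS φ hφ) where
  inner f g := ((of φ hφ).symm f).sum fun a z =>
    ((of φ hφ).symm g).sum fun b w => conj z * w * φ (a⁻¹ * b)
  conj_inner_symm f g := by
    rw [Finsupp.sum_comm]
    simp only [map_finsuppSum]
    refine Finsupp.sum_congr fun a _ => Finsupp.sum_congr fun b _ => ?_
    rw [map_mul, map_mul, Complex.conj_conj, ← hφ.1.map_inv, mul_inv_rev, inv_inv]
    ring
  re_inner_nonneg f := (Complex.le_def.1 (hφ.1.sum_nonneg ((of φ hφ).symm f))).1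
  add_left f g h := by
    rw [map_add, Finsupp.sum_add_index'] <;> simp [← Finsupp.sum_add, add_mul]
  smul_left f g c := by
    rw [map_smul, Finsupp.sum_smul_index] <;> simp [Finsupp.mul_sum, ← mul_assoc]

instance : SeminormedAddCommGroup (PreGNS φ hφ) :=
  InnerProductSpace.Core.toSeminormedAddCommGroup (c := core φ hφ)

instance : InnerProductSpace ℂ (PreGNS φ hφ) := InnerProductSpace.ofCore (core φ hφ)

theorem inner_def (f g : Γ →₀ ℂ) : inner ℂ (of φ hφ f) (of φ hφ g) =
    f.sum fun a z => g.sum fun b w => conj z * w * φ (a⁻¹ * b) := rfl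

/-- Left translation by `γ`, mapping `δ_a` to `δ_{γa}`. -/
def translate (γ : Γ) : PreGNS φ hφ ≃ₗᵢ[ℂ] PreGNS φ hφ :=
  LinearEquiv.isometryOfInner
    ((of φ hφ).symm ≪≫ₗ Finsupp.domLCongr (Equiv.mulLeft γ) ≪≫ₗ of φ hφ) fun f g => by
      obtain ⟨f, rfl⟩ := (of φ hφ).surjective f
      obtain ⟨g, rfl⟩ := (of φ hφ).surjective g
      simp [inner_def, Finsupp.equivMapDomain_eq_mapDomain, Finsupp.sum_mapDomain_index, mul_add,
        add_mul, mul_assoc]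

theorem translate_single (γ a : Γ) (z : ℂ) :
    translate φ hφ γ (of φ hφ (Finsupp.single a z)) = of φ hφ (Finsupp.single (γ * a) z) := by
  simp [translate]

/-- The vector space of the GNS representation, the Hilbert space completion of `PreGNS φ hφ`. -/
abbrev Compl : Type u := UniformSpace.Completion (PreGNS φ hφ)

/-- Left translation by `γ`, extended to the completion. -/
def translateCompl (γ : Γ) : Compl φ hφ →L[ℂ] Compl φ hφ :=
  ((translate φ hφ γ).toContinuousLinearEquiv :
    PreGNS φ hφ →L[ℂ] PreGNS φ hφ).completion

theorem translateCompl_coe (γ : Γ) (x : PreGNS φ hφ) :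
    translateCompl φ hφ γ (x : Compl φ hφ) = (translate φ hφ γ x : PreGNS φ hφ) :=
  ContinuousLinearMap.completion_apply_coe _ _

theorem translate_one (x : PreGNS φ hφ) : translate φ hφ 1 x = x := by
  obtain ⟨f, rfl⟩ := (of φ hφ).surjective x
  simp [translate, Finsupp.equivMapDomain_eq_mapDomain]

theorem translate_mul (γ δ : Γ) (x : PreGNS φ hφ) :
    translate φ hφ (γ * δ) x = translate φ hφ γ (translate φ hφ δ x) := by
  obtain ⟨f, rfl⟩ := (of φ hφ).surjective x
  simp [translate, Finsupp.equivMapDomain_eq_mapDomain, ← Finsupp.mapDomain_comp,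
    Function.comp_def]

theorem translateCompl_one (x : Compl φ hφ) : translateCompl φ hφ 1 x = x := by
  induction x using UniformSpace.Completion.induction_on with
  | hp => exact isClosed_eq (translateCompl φ hφ 1).continuous continuous_id
  | ih x => rw [translateCompl_coe, translate_one]

theorem translateCompl_mul (γ δ : Γ) (x : Compl φ hφ) :
    translateCompl φ hφ (γ * δ) x = translateCompl φ hφ γ (translateCompl φ hφ δ x) := by
  induction x using UniformSpace.Completion.induction_on with
  | hp =>
    exact isClosed_eq (translateCompl φ hφ _).continuous
      ((translateCompl φ hφ γ).continuous.comp (translateCompl φ hφ δ).continuous)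
  | ih x => rw [translateCompl_coe, translateCompl_coe, translateCompl_coe, translate_mul]

theorem norm_translateCompl (γ : Γ) (x : Compl φ hφ) : ‖translateCompl φ hφ γ x‖ = ‖x‖ := by
  induction x using UniformSpace.Completion.induction_on with
  | hp => exact isClosed_eq (translateCompl φ hφ γ).continuous.norm continuous_norm
  | ih x =>
    rw [translateCompl_coe, UniformSpace.Completion.norm_coe, UniformSpace.Completion.norm_coe,
      LinearIsometryEquiv.norm_map]

end PreGNS

/-- The GNS representation `π_φ` of the trace `φ`. -/
def gnsRep (φ : Γ → ℂ) (hφ : φ ∈ traceSet Γ) : UnitaryRep Γ where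
  H := PreGNS.Compl φ hφ
  act :=
    { toFun := fun γ =>
        { toFun := PreGNS.translateCompl φ hφ γ
          map_add' := map_add _
          map_smul' := map_smul _
          invFun := PreGNS.translateCompl φ hφ γ⁻¹
          left_inv := fun x => by
            rw [← PreGNS.translateCompl_mul, inv_mul_cancel, PreGNS.translateCompl_one]
          right_inv := fun x => by
            rw [← PreGNS.translateCompl_mul, mul_inv_cancel, PreGNS.translateCompl_one]
          norm_map' := PreGNS.norm_translateCompl φ hφ γ }
      map_one' := LinearIsometryEquiv.ext (PreGNS.translateCompl_one φ hφ)
      map_mul' := fun γ δ => LinearIsometryEquiv.ext (PreGNS.translateCompl_mul φ hφ γ δ) }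

/-- The cyclic vector `v_φ` of the GNS representation: the class of `δ_e`. -/
def gnsVec (φ : Γ → ℂ) (hφ : φ ∈ traceSet Γ) : (gnsRep φ hφ).H :=
  ((PreGNS.of φ hφ (Finsupp.single 1 1) : PreGNS φ hφ) : PreGNS.Compl φ hφ)

theorem gnsRep_act_gnsVec (φ : Γ → ℂ) (hφ : φ ∈ traceSet Γ) (γ : Γ) :
    (gnsRep φ hφ).act γ (gnsVec φ hφ) =
      ((PreGNS.of φ hφ (Finsupp.single γ 1) : PreGNS φ hφ) : PreGNS.Compl φ hφ) := by
  change PreGNS.translateCompl φ hφ γ _ = _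
  rw [gnsVec, PreGNS.translateCompl_coe, PreGNS.translate_single, mul_one]

/-- The GNS formula `φ(γ) = ⟨π_φ(γ) v_φ, v_φ⟩`. -/
theorem gnsRep_coeff (φ : Γ → ℂ) (hφ : φ ∈ traceSet Γ) (γ : Γ) :
    (gnsRep φ hφ).coeff (gnsVec φ hφ) γ = φ γ := by
  rw [UnitaryRep.coeff, gnsRep_act_gnsVec]
  refine (UniformSpace.Completion.inner_coe (𝕜 := ℂ) _ _).trans ?_
  rw [PreGNS.inner_def]
  simp

/-- The vector `v_φ` is cyclic for `π_φ`. -/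
theorem gnsVec_cyclic (φ : Γ → ℂ) (hφ : φ ∈ traceSet Γ) :
    (Submodule.span ℂ (Set.range fun γ : Γ =>
      (gnsRep φ hφ).act γ (gnsVec φ hφ))).topologicalClosure = ⊤ := by
  rw [← Submodule.dense_iff_topologicalClosure_eq_top]
  refine (UniformSpace.Completion.denseRange_coe (α := PreGNS φ hφ)).mono ?_
  rintro _ ⟨x, rfl⟩
  obtain ⟨f, rfl⟩ := (PreGNS.of φ hφ).surjective x
  induction f using Finsupp.induction_linear with
  | zero =>
    rw [map_zero]
    exact Submodule.zero_mem _
  | add f g hf hg =>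
    rw [map_add, UniformSpace.Completion.coe_add]
    exact Submodule.add_mem _ hf hg
  | single a z =>
    have h : (Finsupp.single a z : Γ →₀ ℂ) = z • Finsupp.single a 1 := by simp
    rw [h, map_smul, UniformSpace.Completion.coe_smul]
    refine Submodule.smul_mem (Submodule.span ℂ (Set.range fun γ : Γ =>
      (gnsRep φ hφ).act γ (gnsVec φ hφ))) z ?_
    rw [← gnsRep_act_gnsVec φ hφ a]
    exact Submodule.subset_span ⟨a, rfl⟩

/-- A trace is finite-dimensional if its GNS representation is. -/
def IsFiniteDimTrace (φ : Γ → ℂ) (hφ : φ ∈ traceSet Γ) : Prop :=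
  FiniteDimensional ℂ (gnsRep φ hφ).H

/-- The set `Ch(Γ; R)` of the characters whose GNS representation belongs to `R`. -/
def charSetRel (R : Set (UnitaryRep Γ)) : Set (Γ → ℂ) :=
  {φ | ∃ hφ : φ ∈ charSet Γ, gnsRep φ (charSet_subset hφ) ∈ R}

end Traces

end

/-!
A finite-dimensional character `φ` has a neighbourhood in which all characters `ψ` with `π_ψ ∈ R`
coincide (`exists_isOpen_subsingleton`); topology alone then makes `φ` isolated in the closure of
this set of characters. Property (T) is property `T(R)` for the family of all representations, and
this gives the second part.

The neighbourhood is found in two steps. Both use property `T(R)` for restrictions to the diagonal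
of representations of `Γ × Γ` that restrict on one factor to a representation from `R` and on the
other one to a subrepresentation of the dual of such a representation; they are in `R` because `R`
is hereditary.

*Nearby characters have the same dimension* (`eventually_finrank_gnsRep_eq`). Let the elements `xᵢ`
of `ℂ[Γ]` represent an orthonormal basis of the space of `π_φ`, which has dimension `n`. The vectors
`∑ xᵢ h xᵢ* v_φ` are invariant under conjugation by `Γ`, and for `ψ` near `φ` the vectors
`∑ xᵢ h xᵢ* v_ψ` are almost invariant, uniformly in `h ∈ Γ`. If `π_ψ ∈ R`, then `Γ` acts by
conjugation on the space of `π_ψ` through a representation in `R`, so these vectors are close to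
invariant ones, and as `ψ` is a character, the invariant vectors are the multiples of `v_ψ`. It
follows that `n |ψ(h)|²` is, uniformly in `h`, close to `∑ ⟨h xᵢ h⁻¹ v_ψ, xᵢ v_ψ⟩`
(`eventually_norm_sum_coeff_sub_le`). The mean of this positive definite function of `h` is at least
`∑ |⟨xᵢ v_ψ, v_ψ⟩|²`, which is close to `1`. On the other hand the mean of `|ψ|²` over `Γ` is at
most `1 / dim π_ψ` (`exists_mean_normSq`). Hence `dim π_ψ` is not larger than `n`, and it is not smaller
because the `xᵢ v_ψ` are linearly independent.

*Nearby characters of the same dimension coincide* (`eq_of_norm_pairForm_lt`). A finite-dimensional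
character is the normalized trace of an irreducible representation by unitary matrices
(`exists_matrix_representation`), whose size `d` satisfies `d² = dim π_ψ`. For characters `ψ`, `ψ'`
near `φ`, given by `u` and `u'`, let `g ∈ Γ` act on `d × d` matrices by `X ↦ u(g) X u'(g)⁻¹`. A
suitable sum of coefficients of this representation is a continuous function of the pair `(ψ, ψ')`
that is constantly `1` at `(φ, φ)`. By property `T(R)` the representation has a non-zero invariant
vector, which is an intertwiner of `u'` and `u`, and so `ψ = ψ'`.

Both steps rest on the minimality of characters: a class function whose hermitian form is bounded
by that of a character is a multiple of it (`eq_mul_of_bounded`). This takes the place of the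
factoriality of the von Neumann algebra generated by `π_ψ`. Means over `Γ` are projections onto
invariant vectors, which lie in the closed convex hull of the orbit (`invariants_proj_mem`).
-/

section

variable {Γ : Type u} [Group Γ]

/-! ### Elementary properties of unitary representations -/

namespace UnitaryRep

theorem act_mul_apply (π : UnitaryRep Γ) (γ δ : Γ) (x : π.H) :
    π.act (γ * δ) x = π.act γ (π.act δ x) := by
  rw [map_mul]; rfl

theorem act_one_apply (π : UnitaryRep Γ) (x : π.H) : π.act 1 x = x := by
  rw [map_one]; rfl

theorem inner_act_act (π : UnitaryRep Γ) (γ : Γ) (x y : π.H) :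
    inner ℂ (π.act γ x) (π.act γ y) = inner ℂ x y :=
  (π.act γ).inner_map_map x y

theorem inner_act_left (π : UnitaryRep Γ) (γ : Γ) (x y : π.H) :
    inner ℂ (π.act γ x) y = inner ℂ x (π.act γ⁻¹ y) := by
  rw [← π.inner_act_act γ x, act_act_inv]

theorem inner_act_act' (π : UnitaryRep Γ) (γ δ : Γ) (x y : π.H) :
    inner ℂ (π.act γ x) (π.act δ y) = inner ℂ x (π.act (γ⁻¹ * δ) y) := by
  rw [inner_act_left, act_mul_apply]

/-! ### Cyclic vectors and uniqueness of the GNS construction -/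

/-- The map `∑ a, x a • a ↦ ∑ a, x a • π(a) ξ` from `ℂ[Γ]` to the space of `π`. -/
noncomputable def orbitMap (π : UnitaryRep Γ) (ξ : π.H) : (Γ →₀ ℂ) →ₗ[ℂ] π.H :=
  Finsupp.linearCombination ℂ fun γ => π.act γ ξ

theorem orbitMap_single (π : UnitaryRep Γ) (ξ : π.H) (γ : Γ) (z : ℂ) :
    π.orbitMap ξ (Finsupp.single γ z) = z • π.act γ ξ := by
  simp [orbitMap]

theorem orbitMap_apply (π : UnitaryRep Γ) (ξ : π.H) (x : Γ →₀ ℂ) :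
    π.orbitMap ξ x = x.sum fun a z => z • π.act a ξ := rfl

theorem inner_orbitMap (π : UnitaryRep Γ) (ξ : π.H) (x y : Γ →₀ ℂ) :
    inner ℂ (π.orbitMap ξ x) (π.orbitMap ξ y) =
      x.sum fun a z => y.sum fun b w => conj z * w * π.coeff ξ (a⁻¹ * b) := by
  simp only [orbitMap_apply, Finsupp.sum, sum_inner, inner_sum, inner_smul_left, inner_smul_right,
    inner_act_act', coeff, Finset.mul_sum]
  rw [Finset.sum_comm]
  exact Finset.sum_congr rfl fun a _ => Finset.sum_congr rfl fun b _ => by ring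

/-- Two continuous maps agreeing on the orbit of a cyclic vector are equal. -/
theorem ext_of_cyclic {π : UnitaryRep Γ} {ξ : π.H} (h : DenseRange (π.orbitMap ξ))
    {F : Type*} [NormedAddCommGroup F] [NormedSpace ℂ F] {S T : π.H →L[ℂ] F}
    (hST : ∀ γ, S (π.act γ ξ) = T (π.act γ ξ)) : S = T := by
  refine ContinuousLinearMap.coeFn_injective (h.equalizer S.continuous T.continuous ?_)
  funext x
  simp only [Function.comp_apply, orbitMap_apply, Finsupp.sum, map_sum, map_smul, hST]

theorem eq_zero_of_cyclic {π : UnitaryRep Γ} {ξ : π.H} (h : DenseRange (π.orbitMap ξ))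
    {x : π.H} (hx : ∀ γ, inner ℂ x (π.act γ ξ) = 0) : x = 0 := by
  have : innerSL ℂ x = 0 := ext_of_cyclic h fun γ => by simpa using hx γ
  simpa using congrArg (fun f => f x) this

/-- A representation with a cyclic vector is contained in every representation that has the same
function of positive type as a coefficient. -/
theorem exists_isometry_of_coeff_eq {ρ π : UnitaryRep Γ} {ξ : ρ.H} {η : π.H}
    (h : DenseRange (ρ.orbitMap ξ)) (hc : ∀ γ, ρ.coeff ξ γ = π.coeff η γ) :
    ∃ V : ρ.H →ₗᵢ[ℂ] π.H, (∀ γ x, V (ρ.act γ x) = π.act γ (V x)) ∧ V ξ = η := by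
  have hn (x : Γ →₀ ℂ) : ‖π.orbitMap η x‖ = ‖ρ.orbitMap ξ x‖ := by
    have : inner ℂ (π.orbitMap η x) (π.orbitMap η x) =
        inner ℂ (ρ.orbitMap ξ x) (ρ.orbitMap ξ x) := by
      simp only [inner_orbitMap, hc]
    rw [@norm_eq_sqrt_re_inner ℂ, @norm_eq_sqrt_re_inner ℂ, this]
  let V₀ := (π.orbitMap η).extendOfNorm (ρ.orbitMap ξ)
  have hV₀ (x : Γ →₀ ℂ) : V₀ (ρ.orbitMap ξ x) = π.orbitMap η x :=
    LinearMap.extendOfNorm_eq h ⟨1, fun x => by rw [hn, one_mul]⟩ x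
  have hV₁ (γ : Γ) : V₀ (ρ.act γ ξ) = π.act γ η := by
    simpa [orbitMap_single] using hV₀ (Finsupp.single γ 1)
  let V : ρ.H →ₗᵢ[ℂ] π.H := ⟨V₀, fun x => by
    refine h.induction_on (p := fun x => ‖V₀ x‖ = ‖x‖) x
      (isClosed_eq V₀.continuous.norm continuous_norm) fun x => ?_
    rw [hV₀, hn]⟩
  refine ⟨V, fun γ => ?_, ?_⟩
  · have := ext_of_cyclic h (S := V₀.comp (ρ.act γ : ρ.H →L[ℂ] ρ.H))
      (T := (π.act γ : π.H →L[ℂ] π.H).comp V₀) fun δ => by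
        change V₀ (ρ.act γ (ρ.act δ ξ)) = π.act γ (V₀ (ρ.act δ ξ))
        rw [← act_mul_apply, hV₁, hV₁, act_mul_apply]
    exact fun x => congrArg (fun f => f x) this
  · have := hV₁ 1
    rwa [act_one_apply, act_one_apply] at this

theorem isSubrep_of_coeff_eq {ρ π : UnitaryRep Γ} {ξ : ρ.H} {η : π.H}
    (h : DenseRange (ρ.orbitMap ξ)) (hc : ∀ γ, ρ.coeff ξ γ = π.coeff η γ) : ρ.IsSubrep π :=
  let ⟨V, hV, _⟩ := exists_isometry_of_coeff_eq h hc
  ⟨V, hV⟩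

/-! ### The projection onto the invariant vectors as a mean of the orbit -/

theorem isClosed_invariants (π : UnitaryRep Γ) : IsClosed (π.invariants : Set π.H) := by
  have : (π.invariants : Set π.H) = ⋂ γ, {x | π.act γ x = x} := by
    ext x; simp [invariants]
  rw [this]
  exact isClosed_iInter fun γ => isClosed_eq (π.act γ).continuous continuous_id

instance (π : UnitaryRep Γ) : CompleteSpace π.invariants :=
  π.isClosed_invariants.completeSpace_coe

/-- A closed convex set containing the orbit of `v` contains the projection of `v` onto the
invariant vectors: the point of minimal norm of the closed convex hull of the orbit is invariant. -/
theorem invariants_proj_mem (π : UnitaryRep Γ) (v : π.H) {S : Set π.H} (hc : Convex ℝ S)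
    (hS : IsClosed S) (hv : ∀ γ, π.act γ v ∈ S) : π.invariants.starProjection v ∈ S := by
  let _ : InnerProductSpace ℝ π.H := InnerProductSpace.complexToReal
  let O : Set π.H := Set.range fun γ => π.act γ v
  let K : Set π.H := closure (convexHull ℝ O)
  have hKc : Convex ℝ K := (convex_convexHull ℝ _).closure
  have hKS : K ⊆ S := closure_minimal (convexHull_min (by rintro _ ⟨γ, rfl⟩; exact hv γ) hc) hS
  have hOK : O ⊆ K := (subset_convexHull ℝ _).trans subset_closure
  have hKact (γ : Γ) (x : π.H) (hx : x ∈ K) : π.act γ x ∈ K := by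
    have h1 : K ⊆ π.act γ ⁻¹' K := by
      refine closure_minimal (convexHull_min ?_ ?_) (isClosed_closure.preimage (π.act γ).continuous)
      · rintro _ ⟨δ, rfl⟩
        exact hOK ⟨γ * δ, act_mul_apply ..⟩
      · exact hKc.linear_preimage ((π.act γ).toLinearEquiv.toLinearMap.restrictScalars ℝ)
    exact h1 hx
  obtain ⟨z, hzK, hz⟩ := exists_norm_eq_iInf_of_complete_convex (K := K) ⟨_, hOK ⟨1, rfl⟩⟩
    isClosed_closure.isComplete hKc 0
  have hmin := (norm_eq_iInf_iff_real_inner_le_zero hKc hzK).1 hz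
  have hzinv : z ∈ π.invariants := by
    intro γ
    have h1 := hmin _ (hKact γ z hzK)
    rw [zero_sub, inner_neg_left, inner_sub_right, real_inner_self_eq_norm_sq] at h1
    have h2 : ‖π.act γ z - z‖ ^ 2 ≤ 0 := by
      rw [@norm_sub_sq_real, (π.act γ).norm_map, real_inner_comm]
      linarith
    rw [← sub_eq_zero, ← norm_eq_zero]
    exact pow_eq_zero_iff two_ne_zero |>.1 (le_antisymm h2 (sq_nonneg _))
  have hproj : π.invariants.starProjection v = z := by
    refine Submodule.eq_starProjection_of_mem_orthogonal hzinv ?_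
    rw [Submodule.mem_orthogonal]
    intro ζ hζ
    have h1 : K ⊆ {x | inner ℂ ζ x = inner ℂ ζ v} := by
      refine closure_minimal (convexHull_min ?_ ?_)
        (isClosed_eq (continuous_const.inner continuous_id) continuous_const)
      · rintro _ ⟨γ, rfl⟩
        change inner ℂ ζ (π.act γ v) = _
        rw [← π.inner_act_act γ ζ v, hζ γ]
      · exact (convex_singleton (inner ℂ ζ v)).linear_preimage
          ((innerSL ℂ ζ).toLinearMap.restrictScalars ℝ)
    rw [inner_sub_right, show inner ℂ ζ z = inner ℂ ζ v from h1 hzK, sub_self]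
  rw [hproj]
  exact hKS hzK

theorem inner_invariants_proj (π : UnitaryRep Γ) {ζ : π.H} (hζ : ∀ γ, π.act γ ζ = ζ) (x : π.H) :
    inner ℂ ζ (π.invariants.starProjection x) = inner ℂ ζ x := by
  rw [← Submodule.inner_starProjection_left_eq_right,
    Submodule.starProjection_eq_self_iff.2 (show ζ ∈ π.invariants from hζ)]

theorem norm_inner_invariants_proj_le (π : UnitaryRep Γ) (v y : π.H) {c : ℝ}
    (h : ∀ γ, ‖inner ℂ (π.act γ v) y‖ ≤ c) :
    ‖inner ℂ (π.invariants.starProjection v) y‖ ≤ c := by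
  refine π.invariants_proj_mem v (S := {x | ‖inner ℂ x y‖ ≤ c}) ?_
    (isClosed_le (by fun_prop) continuous_const) h
  have := (convex_closedBall (0 : ℂ) c).linear_preimage
    ((innerSL ℂ y).toLinearMap.restrictScalars ℝ)
  convert this using 1
  ext x
  simp [norm_inner_symm x y]

theorem re_inner_invariants_proj_le (π : UnitaryRep Γ) (v y : π.H) {c : ℝ}
    (h : ∀ γ, (inner ℂ (π.act γ v) y).re ≤ c) :
    (inner ℂ (π.invariants.starProjection v) y).re ≤ c := by
  refine π.invariants_proj_mem v (S := {x | (inner ℂ x y).re ≤ c}) ?_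
    (isClosed_le (Complex.continuous_re.comp (by fun_prop)) continuous_const) h
  have := (convex_Iic c).linear_preimage
    (Complex.reLm.comp ((innerSL ℂ y).toLinearMap.restrictScalars ℝ))
  convert this using 1
  ext x
  have h1 : (inner ℂ x y).re = (inner ℂ y x).re := by rw [← inner_conj_symm, Complex.conj_re]
  simp [h1]

/-! ### Spectral gaps from property (T) -/

theorem coeff_one (π : UnitaryRep Γ) (ξ : π.H) : π.coeff ξ 1 = (‖ξ‖ ^ 2 : ℝ) := by
  rw [coeff, act_one_apply, inner_self_eq_norm_sq_to_K]; norm_cast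

theorem coeff_smul (π : UnitaryRep Γ) (c : ℂ) (ξ : π.H) (γ : Γ) :
    π.coeff (c • ξ) γ = (‖c‖ ^ 2 : ℝ) * π.coeff ξ γ := by
  rw [coeff, map_smul, inner_smul_left, inner_smul_right, ← mul_assoc, coeff,
    ← Complex.normSq_eq_conj_mul_self, Complex.normSq_eq_norm_sq]

theorem norm_act_sub_sq (π : UnitaryRep Γ) (ξ : π.H) (γ : Γ) :
    ‖π.act γ ξ - ξ‖ ^ 2 = 2 * ‖ξ‖ ^ 2 - 2 * (π.coeff ξ γ).re := by
  rw [@norm_sub_sq ℂ, (π.act γ).norm_map, coeff]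
  have : RCLike.re (inner ℂ (π.act γ ξ) ξ) = (inner ℂ ξ (π.act γ ξ)).re := by
    rw [← inner_conj_symm, RCLike.conj_re]; rfl
  rw [this]; ring

theorem trivial_coeff (ξ : (trivial Γ).H) (γ : Γ) :
    (trivial Γ).coeff ξ γ = (‖ξ‖ ^ 2 : ℝ) := by
  rw [← coeff_one]; rfl

/-- Every Fell-open set around the trivial representation contains all representations that have a
sum of coefficients close to `1` on a suitable finite set. -/
theorem exists_finset_of_isOpen {U : Set (UnitaryRep Γ)} (hU : IsOpen U) (h1 : trivial Γ ∈ U) :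
    ∃ (Q : Finset Γ) (δ : ℝ), 0 < δ ∧ ∀ (ρ : UnitaryRep Γ) (m : ℕ) (η : Fin m → ρ.H),
      (∀ s ∈ Q, ‖1 - ∑ j, ρ.coeff (η j) s‖ < δ) → ρ ∈ U := by
  classical
  change TopologicalSpace.GenerateOpen _ U at hU
  induction hU with
  | basic s hs =>
    obtain ⟨π, n, ξ, Q, ε, hε, rfl⟩ := hs
    choose m η hη using h1
    let c (i : Fin n) : ℝ := ∑ j, ‖η i j‖ ^ 2
    have hc (i : Fin n) : 0 ≤ c i := by positivity
    have hη' (i : Fin n) (γ : Γ) (hγ : γ ∈ Q) : ‖π.coeff (ξ i) γ - c i‖ < ε := by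
      simpa [trivial_coeff, c] using hη i γ hγ
    have hev : ∀ᶠ t : ℝ in 𝓝[>] 0, ∀ i, ∀ γ ∈ Q, ‖π.coeff (ξ i) γ - c i‖ + c i * t < ε := by
      refine Filter.eventually_all.2 fun i => (Filter.eventually_all_finset Q).2 fun γ hγ => ?_
      refine Filter.Eventually.filter_mono nhdsWithin_le_nhds ?_
      have : Filter.Tendsto (fun t : ℝ => ‖π.coeff (ξ i) γ - c i‖ + c i * t) (𝓝 0)
          (𝓝 (‖π.coeff (ξ i) γ - c i‖ + c i * 0)) := Continuous.tendsto (by fun_prop) 0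
      rw [mul_zero, add_zero] at this
      exact this.eventually (gt_mem_nhds (hη' i γ hγ))
    obtain ⟨δ, hδ, hδ0⟩ := (hev.and self_mem_nhdsWithin).exists
    refine ⟨Q, δ, hδ0, fun ρ m ζ hζ i => ⟨m, fun j => (√(c i) : ℂ) • ζ j, fun γ hγ => ?_⟩⟩
    have h2 : ∑ j, ρ.coeff ((√(c i) : ℂ) • ζ j) γ = c i * ∑ j, ρ.coeff (ζ j) γ := by
      simp only [coeff_smul, Complex.norm_real, Finset.mul_sum]
      simp [Real.sq_sqrt (hc i)]
    calc ‖π.coeff (ξ i) γ - ∑ j, ρ.coeff ((√(c i) : ℂ) • ζ j) γ‖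
        = ‖(π.coeff (ξ i) γ - c i) + c i * (1 - ∑ j, ρ.coeff (ζ j) γ)‖ := by
          rw [h2]; congr 1; ring
      _ ≤ ‖π.coeff (ξ i) γ - c i‖ + c i * ‖1 - ∑ j, ρ.coeff (ζ j) γ‖ := by
          refine (norm_add_le _ _).trans_eq ?_
          rw [norm_mul, Complex.norm_real, Real.norm_of_nonneg (hc i)]
      _ ≤ ‖π.coeff (ξ i) γ - c i‖ + c i * δ := by
          gcongr
          exact (hζ γ hγ).le
      _ < ε := hδ i γ hγ
  | univ => exact ⟨∅, 1, one_pos, fun _ _ _ _ => Set.mem_univ _⟩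
  | inter s t _ _ hs ht =>
    obtain ⟨Q, δ, hδ, h⟩ := hs h1.1
    obtain ⟨Q', δ', hδ', h'⟩ := ht h1.2
    refine ⟨Q ∪ Q', min δ δ', lt_min hδ hδ', fun ρ m η H => ⟨h ρ m η fun s hs => ?_,
      h' ρ m η fun s hs => ?_⟩⟩
    · exact (H s (Finset.mem_union_left _ hs)).trans_le (min_le_left _ _)
    · exact (H s (Finset.mem_union_right _ hs)).trans_le (min_le_right _ _)
  | sUnion S _ hS =>
    obtain ⟨s, hs, h1⟩ := h1
    obtain ⟨Q, δ, hδ, h⟩ := hS s hs h1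
    exact ⟨Q, δ, hδ, fun ρ m η H => ⟨s, hs, h ρ m η H⟩⟩

theorem nontrivialPart_invariants (π : UnitaryRep Γ) (x : π.nontrivialPart.H)
    (hx : ∀ γ, π.nontrivialPart.act γ x = x) : x = 0 := by
  have h1 : x.1 ∈ π.invariants := fun γ => congrArg Subtype.val (hx γ)
  have h2 : inner ℂ x.1 x.1 = 0 := Submodule.inner_right_of_mem_orthogonal h1 x.2
  exact Subtype.ext (inner_self_eq_zero.1 h2)

end UnitaryRep

section PropertyT

open UnitaryRep

/-- Property `T(R)` in terms of coefficients: no representation in `R` has vectors orthogonal to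
the invariant ones whose coefficients sum up to a function close to `1`. -/
theorem HasPropertyTRel.exists_gap {R : Set (UnitaryRep Γ)} (h : HasPropertyTRel R) :
    ∃ (Q : Finset Γ) (δ : ℝ), 0 < δ ∧ ∀ π ∈ R, ∀ (m : ℕ) (η : Fin m → π.H),
      (∀ j, η j ∈ π.invariantsᗮ) → ¬ ∀ s ∈ Q, ‖1 - ∑ j, π.coeff (η j) s‖ < δ := by
  obtain ⟨U, hU, hUS⟩ := h
  have h1 : trivial Γ ∈ U := (hUS.ge rfl).1
  obtain ⟨Q, δ, hδ, H⟩ := exists_finset_of_isOpen hU h1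
  refine ⟨Q, δ, hδ, fun π hπ m η hη hs => ?_⟩
  have h2 : π.nontrivialPart ∈ U :=
    H π.nontrivialPart m (fun j => ⟨η j, hη j⟩) hs
  have h3 : π.nontrivialPart = trivial Γ := hUS.le ⟨h2, Or.inl ⟨π, hπ, rfl⟩⟩
  -- `π₀` has no non-zero invariant vector, while every vector of the trivial one is invariant
  have h4 : ∀ x : (trivial Γ).H, x = 0 := by
    have := π.nontrivialPart_invariants
    rw [h3] at this
    exact fun x => this x fun γ => rfl
  have h5 : (EuclideanSpace.single PUnit.unit 1 : EuclideanSpace ℂ PUnit.{u + 1}) = 0 := h4 _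
  have h6 : (1 : ℂ) = 0 := by
    simpa using congrArg (fun x : EuclideanSpace ℂ PUnit.{u + 1} => x PUnit.unit) h5
  exact one_ne_zero h6

/-- Property `T(R)` as a spectral gap: an almost invariant vector is close to its projection onto
the invariant vectors. -/
theorem HasPropertyTRel.exists_norm_sub_proj_le {R : Set (UnitaryRep Γ)} (h : HasPropertyTRel R) :
    ∃ (Q : Finset Γ) (c : ℝ), 0 < c ∧ ∀ π ∈ R, ∀ (ξ : π.H) (ε : ℝ), 0 ≤ ε →
      (∀ s ∈ Q, ‖π.act s ξ - ξ‖ ≤ ε) → ‖ξ - π.invariants.starProjection ξ‖ ≤ c * ε := by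
  obtain ⟨Q, δ, hδ, H⟩ := h.exists_gap
  refine ⟨Q, δ⁻¹, inv_pos.2 hδ, fun π hπ ξ ε hε hs => ?_⟩
  set ζ := ξ - π.invariants.starProjection ξ with hζ
  by_contra! hlt
  have hζ0 : 0 < ‖ζ‖ := lt_of_le_of_lt (by positivity) hlt
  have hinv : ζ ∈ π.invariantsᗮ := Submodule.sub_starProjection_mem_orthogonal ξ
  have hact (s : Γ) : π.act s ζ - ζ = π.act s ξ - ξ := by
    have : π.act s (π.invariants.starProjection ξ) = π.invariants.starProjection ξ :=
      Submodule.starProjection_apply_mem π.invariants ξ s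
    rw [hζ, map_sub, this]; abel
  refine H π hπ 1 (fun _ => ((‖ζ‖⁻¹ : ℝ) : ℂ) • ζ) (fun _ => Submodule.smul_mem _ _ hinv)
    fun s hsQ => ?_
  rw [Fin.sum_univ_one, coeff_smul, Complex.norm_real, norm_inv, norm_norm]
  have h1 : (1 : ℂ) = ((‖ζ‖⁻¹ ^ 2 : ℝ) : ℂ) * inner ℂ ζ ζ := by
    rw [inner_self_eq_norm_sq_to_K]
    change (1 : ℂ) = ((‖ζ‖⁻¹ ^ 2 : ℝ) : ℂ) * (‖ζ‖ : ℂ) ^ 2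
    rw [← Complex.ofReal_pow, ← Complex.ofReal_mul, ← mul_pow, inv_mul_cancel₀ hζ0.ne', one_pow,
      Complex.ofReal_one]
  rw [h1, coeff, ← mul_sub, ← inner_sub_right, norm_mul, Complex.norm_real,
    Real.norm_of_nonneg (by positivity)]
  calc ‖ζ‖⁻¹ ^ 2 * ‖inner ℂ ζ (ζ - π.act s ζ)‖ ≤ ‖ζ‖⁻¹ ^ 2 * (‖ζ‖ * ε) := by
        gcongr
        refine (norm_inner_le_norm _ _).trans ?_
        gcongr
        rw [norm_sub_rev, hact]
        exact hs s hsQ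
    _ = ‖ζ‖⁻¹ * ε := by field_simp
    _ < δ := by
        rw [inv_mul_lt_iff₀ hδ] at hlt
        rw [inv_mul_lt_iff₀ hζ0, mul_comm]
        exact hlt

/-- Kazhdan's property (T) is property `T(R)` for the family `R` of all representations. -/
theorem HasPropertyT.hasPropertyTRel_univ (h : HasPropertyT Γ) :
    HasPropertyTRel (Set.univ : Set (UnitaryRep Γ)) := by
  classical
  obtain ⟨Q, ε, hε, H⟩ := h
  let e : (trivial Γ).H := EuclideanSpace.single PUnit.unit (1 : ℂ)
  have he : ‖e‖ = 1 := by
    change ‖(EuclideanSpace.single PUnit.unit (1 : ℂ) : EuclideanSpace ℂ PUnit.{u + 1})‖ = 1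
    simp
  -- the values of coefficients at `1` are squared norms; `1` is added to `Q` to control them
  let Q' := insert 1 Q
  obtain ⟨δ, hδ0, hδ⟩ : ∃ δ : ℝ, 0 < δ ∧ (Q.card + 1) * (4 * δ) < ε ^ 2 * (1 - δ) := by
    have h1 : Filter.Tendsto (fun t : ℝ => ε ^ 2 * (1 - t) - (Q.card + 1) * (4 * t)) (𝓝 0)
        (𝓝 (ε ^ 2 * (1 - 0) - (Q.card + 1) * (4 * 0))) := Continuous.tendsto (by fun_prop) 0
    have h2 := h1.eventually (lt_mem_nhds (a := 0) (by simp; positivity))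
    obtain ⟨δ, h3, h4⟩ := ((h2.filter_mono nhdsWithin_le_nhds).and
      (self_mem_nhdsWithin (s := Set.Ioi (0 : ℝ)))).exists
    exact ⟨δ, h4, by linarith⟩
  refine ⟨fellNhd (trivial Γ) (fun _ : Fin 1 => e) Q' δ,
    .basic _ ⟨_, _, _, _, _, hδ0, rfl⟩, ?_⟩
  ext ρ
  refine ⟨?_, ?_⟩
  swap
  · rintro rfl
    refine ⟨fun i => ⟨1, fun _ => e, fun γ _ => ?_⟩, Or.inr rfl⟩
    simpa using hδ0
  rintro ⟨hρ, ⟨π, -, rfl⟩ | hρ'⟩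
  swap
  · exact hρ'
  exfalso
  obtain ⟨ρ, hρπ⟩ : ∃ ρ, ρ = π.nontrivialPart := ⟨_, rfl⟩
  rw [← hρπ] at hρ
  obtain ⟨m, η, hη⟩ := hρ 0
  simp only [trivial_coeff, he] at hη
  have hone : 1 - δ < ∑ j, ‖η j‖ ^ 2 := by
    have h1 := hη 1 (Finset.mem_insert_self _ _)
    simp only [coeff_one] at h1
    have h2 := (Complex.abs_re_le_norm _).trans_lt h1
    simp only [one_pow, Complex.ofReal_one, ← Complex.ofReal_sum, Complex.sub_re, Complex.one_re,
      Complex.ofReal_re] at h2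
    linarith [(abs_lt.1 h2).2]
  have hsum (s : Γ) (hs : s ∈ Q) : ∑ j, ‖ρ.act s (η j) - η j‖ ^ 2 < 4 * δ := by
    simp only [norm_act_sub_sq, Finset.sum_sub_distrib, ← Finset.mul_sum]
    have h1 := (Complex.abs_re_le_norm _).trans_lt (hη s (Finset.mem_insert_of_mem hs))
    have h2 := (Complex.abs_re_le_norm _).trans_lt (hη 1 (Finset.mem_insert_self _ _))
    simp only [coeff_one, one_pow, Complex.ofReal_one, ← Complex.ofReal_sum, Complex.sub_re,
      Complex.one_re, Complex.ofReal_re, Complex.re_sum] at h1 h2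
    linarith [(abs_lt.1 h1).2, (abs_lt.1 h2).1]
  -- on average over `j`, the vector `η j` is moved little by all elements of `Q`
  have htot : ∑ j, ∑ s ∈ Q, ‖ρ.act s (η j) - η j‖ ^ 2 < ∑ j, ε ^ 2 * ‖η j‖ ^ 2 := by
    rw [Finset.sum_comm, ← Finset.mul_sum]
    calc ∑ s ∈ Q, ∑ j, ‖ρ.act s (η j) - η j‖ ^ 2 ≤ ∑ s ∈ Q, 4 * δ :=
          Finset.sum_le_sum fun s hs => (hsum s hs).le
      _ = Q.card * (4 * δ) := by simp
      _ ≤ (Q.card + 1) * (4 * δ) := by gcongr; linarith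
      _ < ε ^ 2 * (1 - δ) := hδ
      _ ≤ ε ^ 2 * ∑ j, ‖η j‖ ^ 2 := by gcongr
  obtain ⟨j, -, hj⟩ := Finset.exists_lt_of_sum_lt htot
  have hj0 : η j ≠ 0 := by
    intro h0
    simp [h0] at hj
  obtain ⟨x, hx, hxinv⟩ := H ρ ⟨η j, hj0, fun s hs => by
    have h1 : ‖ρ.act s (η j) - η j‖ ^ 2 < (ε * ‖η j‖) ^ 2 := by
      rw [mul_pow]
      exact (Finset.single_le_sum (f := fun s => ‖ρ.act s (η j) - η j‖ ^ 2)
        (fun _ _ => sq_nonneg _) hs).trans_lt hj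
    exact lt_of_pow_lt_pow_left₀ 2 (by positivity) h1⟩
  subst hρπ
  exact hx (π.nontrivialPart_invariants x hxinv)

end PropertyT

/-! ### The two-sided GNS representation -/

theorem gnsRep_denseRange (φ : Γ → ℂ) (hφ : φ ∈ traceSet Γ) :
    DenseRange ((gnsRep φ hφ).orbitMap (gnsVec φ hφ)) := by
  have h := gnsVec_cyclic φ hφ
  rw [← Submodule.dense_iff_topologicalClosure_eq_top] at h
  rw [DenseRange, ← LinearMap.coe_range, UnitaryRep.orbitMap, Finsupp.range_linearCombination]
  exact h

theorem norm_gnsVec (φ : Γ → ℂ) (hφ : φ ∈ traceSet Γ) : ‖gnsVec φ hφ‖ = 1 := by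
  have h1 := (gnsRep φ hφ).coeff_one (gnsVec φ hφ)
  rw [gnsRep_coeff, hφ.2.2] at h1
  have h2 : ‖gnsVec φ hφ‖ ^ 2 = 1 := by exact_mod_cast h1.symm
  exact (pow_eq_one_iff_of_nonneg (norm_nonneg _) two_ne_zero).1 h2

/-- The translate `a v_φ` of the cyclic vector, that is, the class of `δ_a`. -/
noncomputable def gnsDelta (φ : Γ → ℂ) (hφ : φ ∈ traceSet Γ) (a : Γ) : (gnsRep φ hφ).H :=
  (gnsRep φ hφ).act a (gnsVec φ hφ)

theorem act_gnsDelta (φ : Γ → ℂ) (hφ : φ ∈ traceSet Γ) (a b : Γ) :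
    (gnsRep φ hφ).act a (gnsDelta φ hφ b) = gnsDelta φ hφ (a * b) :=
  ((gnsRep φ hφ).act_mul_apply ..).symm

theorem gnsDelta_one (φ : Γ → ℂ) (hφ : φ ∈ traceSet Γ) : gnsDelta φ hφ 1 = gnsVec φ hφ :=
  (gnsRep φ hφ).act_one_apply _

theorem inner_gnsDelta (φ : Γ → ℂ) (hφ : φ ∈ traceSet Γ) (a b : Γ) :
    inner ℂ (gnsDelta φ hφ a) (gnsDelta φ hφ b) = φ (a⁻¹ * b) := by
  rw [gnsDelta, gnsDelta, UnitaryRep.inner_act_act', ← gnsRep_coeff φ hφ, UnitaryRep.coeff]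

theorem norm_gnsDelta (φ : Γ → ℂ) (hφ : φ ∈ traceSet Γ) (a : Γ) : ‖gnsDelta φ hφ a‖ = 1 := by
  rw [gnsDelta, LinearIsometryEquiv.norm_map, norm_gnsVec]

theorem trace_conj {φ : Γ → ℂ} (hφ : φ ∈ traceSet Γ) (k γ : Γ) : φ (k * γ * k⁻¹) = φ γ := by
  simpa using hφ.2.1 k⁻¹ γ

theorem trace_mul_comm {φ : Γ → ℂ} (hφ : φ ∈ traceSet Γ) (a b : Γ) : φ (a * b) = φ (b * a) := by
  rw [← trace_conj hφ b (a * b)]; group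

/-- Right translation by `γ` on the space of the GNS representation: the unitary operator in the
commutant of `π_φ` that maps `v_φ` to `γ⁻¹ v_φ`. -/
theorem exists_rightTranslation (φ : Γ → ℂ) (hφ : φ ∈ traceSet Γ) (γ : Γ) :
    ∃ V : (gnsRep φ hφ).H →ₗᵢ[ℂ] (gnsRep φ hφ).H,
      ∀ a, V (gnsDelta φ hφ a) = gnsDelta φ hφ (a * γ⁻¹) := by
  obtain ⟨V, hV, hv⟩ := UnitaryRep.exists_isometry_of_coeff_eq (gnsRep_denseRange φ hφ)
    (π := gnsRep φ hφ) (η := gnsDelta φ hφ γ⁻¹) fun a => by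
      rw [gnsRep_coeff, UnitaryRep.coeff, act_gnsDelta, inner_gnsDelta, ← trace_conj hφ γ a,
        inv_inv, mul_assoc]
  exact ⟨V, fun a => by rw [gnsDelta, hV, hv, act_gnsDelta]⟩

/-- Right translation by `γ`, mapping `a v_φ` to `a γ⁻¹ v_φ`. -/
noncomputable def rightTranslation (φ : Γ → ℂ) (hφ : φ ∈ traceSet Γ) (γ : Γ) :
    (gnsRep φ hφ).H →ₗᵢ[ℂ] (gnsRep φ hφ).H :=
  (exists_rightTranslation φ hφ γ).choose

theorem rightTranslation_gnsDelta (φ : Γ → ℂ) (hφ : φ ∈ traceSet Γ) (γ a : Γ) :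
    rightTranslation φ hφ γ (gnsDelta φ hφ a) = gnsDelta φ hφ (a * γ⁻¹) :=
  (exists_rightTranslation φ hφ γ).choose_spec a

theorem gns_ext {φ : Γ → ℂ} {hφ : φ ∈ traceSet Γ} {F : Type*} [NormedAddCommGroup F]
    [NormedSpace ℂ F] {S T : (gnsRep φ hφ).H →L[ℂ] F}
    (h : ∀ a, S (gnsDelta φ hφ a) = T (gnsDelta φ hφ a)) (x : (gnsRep φ hφ).H) : S x = T x :=
  congrArg (fun f => f x) (UnitaryRep.ext_of_cyclic (gnsRep_denseRange φ hφ) h)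

theorem rightTranslation_act (φ : Γ → ℂ) (hφ : φ ∈ traceSet Γ) (γ δ : Γ) (x : (gnsRep φ hφ).H) :
    rightTranslation φ hφ γ ((gnsRep φ hφ).act δ x) =
      (gnsRep φ hφ).act δ (rightTranslation φ hφ γ x) :=
  gns_ext (S := (rightTranslation φ hφ γ).toContinuousLinearMap.comp
      ((gnsRep φ hφ).act δ : (gnsRep φ hφ).H →L[ℂ] (gnsRep φ hφ).H))
    (T := ((gnsRep φ hφ).act δ : (gnsRep φ hφ).H →L[ℂ] (gnsRep φ hφ).H).comp
      (rightTranslation φ hφ γ).toContinuousLinearMap) (fun a => by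
        change rightTranslation φ hφ γ ((gnsRep φ hφ).act δ (gnsDelta φ hφ a)) =
          (gnsRep φ hφ).act δ (rightTranslation φ hφ γ (gnsDelta φ hφ a))
        simp only [act_gnsDelta, rightTranslation_gnsDelta, mul_assoc]) x

theorem rightTranslation_mul (φ : Γ → ℂ) (hφ : φ ∈ traceSet Γ) (γ δ : Γ) (x : (gnsRep φ hφ).H) :
    rightTranslation φ hφ (γ * δ) x = rightTranslation φ hφ γ (rightTranslation φ hφ δ x) :=
  gns_ext (S := (rightTranslation φ hφ (γ * δ)).toContinuousLinearMap)
    (T := (rightTranslation φ hφ γ).toContinuousLinearMap.comp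
      (rightTranslation φ hφ δ).toContinuousLinearMap) (fun a => by
        change rightTranslation φ hφ (γ * δ) (gnsDelta φ hφ a) =
          rightTranslation φ hφ γ (rightTranslation φ hφ δ (gnsDelta φ hφ a))
        simp only [rightTranslation_gnsDelta, mul_assoc, mul_inv_rev]) x

theorem rightTranslation_one (φ : Γ → ℂ) (hφ : φ ∈ traceSet Γ) (x : (gnsRep φ hφ).H) :
    rightTranslation φ hφ 1 x = x :=
  gns_ext (S := (rightTranslation φ hφ 1).toContinuousLinearMap)
    (T := ContinuousLinearMap.id ℂ _) (fun a => by
      change rightTranslation φ hφ 1 (gnsDelta φ hφ a) = gnsDelta φ hφ a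
      rw [rightTranslation_gnsDelta, inv_one, mul_one]) x

/-- The action of `Γ × Γ` on the space of the GNS representation by left and right translations:
`(g, h)` maps `a v_φ` to `g a h⁻¹ v_φ`. -/
noncomputable def gnsBiAct (φ : Γ → ℂ) (hφ : φ ∈ traceSet Γ) :
    Γ × Γ →* ((gnsRep φ hφ).H ≃ₗᵢ[ℂ] (gnsRep φ hφ).H) where
  toFun g :=
    { toFun := fun x => (gnsRep φ hφ).act g.1 (rightTranslation φ hφ g.2 x)
      map_add' := fun x y => by rw [map_add, map_add]
      map_smul' := fun c x => by rw [map_smul, map_smul]; rfl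
      invFun := fun x => (gnsRep φ hφ).act g.1⁻¹ (rightTranslation φ hφ g.2⁻¹ x)
      left_inv := fun x => by
        dsimp only
        rw [rightTranslation_act, ← rightTranslation_mul, inv_mul_cancel, rightTranslation_one,
          UnitaryRep.act_inv_act]
      right_inv := fun x => by
        dsimp only
        rw [rightTranslation_act, ← rightTranslation_mul, mul_inv_cancel, rightTranslation_one,
          UnitaryRep.act_act_inv]
      norm_map' := fun x => by
        change ‖(gnsRep φ hφ).act g.1 (rightTranslation φ hφ g.2 x)‖ = ‖x‖
        rw [LinearIsometryEquiv.norm_map, LinearIsometry.norm_map] }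
  map_one' := by
    ext x
    change (gnsRep φ hφ).act 1 (rightTranslation φ hφ 1 x) = x
    rw [rightTranslation_one, UnitaryRep.act_one_apply]
  map_mul' g h := by
    ext x
    change (gnsRep φ hφ).act (g.1 * h.1) (rightTranslation φ hφ (g.2 * h.2) x) =
      (gnsRep φ hφ).act g.1 (rightTranslation φ hφ g.2
        ((gnsRep φ hφ).act h.1 (rightTranslation φ hφ h.2 x)))
    rw [rightTranslation_mul, UnitaryRep.act_mul_apply, rightTranslation_act]

theorem gnsBiAct_gnsDelta (φ : Γ → ℂ) (hφ : φ ∈ traceSet Γ) (g h a : Γ) :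
    gnsBiAct φ hφ (g, h) (gnsDelta φ hφ a) = gnsDelta φ hφ (g * a * h⁻¹) := by
  change (gnsRep φ hφ).act g (rightTranslation φ hφ h (gnsDelta φ hφ a)) = _
  rw [rightTranslation_gnsDelta, act_gnsDelta, mul_assoc]

theorem gnsBiAct_mul (φ : Γ → ℂ) (hφ : φ ∈ traceSet Γ) (g h : Γ × Γ) (x : (gnsRep φ hφ).H) :
    gnsBiAct φ hφ (g * h) x = gnsBiAct φ hφ g (gnsBiAct φ hφ h x) := by
  rw [map_mul]; rfl

/-- The two-sided GNS representation of `Γ × Γ`. -/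
noncomputable def gnsBi (φ : Γ → ℂ) (hφ : φ ∈ traceSet Γ) : UnitaryRep (Γ × Γ) where
  H := (gnsRep φ hφ).H
  act := gnsBiAct φ hφ

/-- The representation of `Γ` by conjugation on the space of the GNS representation. -/
noncomputable abbrev gnsConj (φ : Γ → ℂ) (hφ : φ ∈ traceSet Γ) : UnitaryRep Γ :=
  (gnsBi φ hφ).comap ((MonoidHom.id Γ).prod (MonoidHom.id Γ))

/-- The mean of a vector under a group of unitary operators. -/
theorem UnitaryRep.exists_mean (π : UnitaryRep Γ) (x : π.H) :
    ∃ z : π.H, (∀ s, π.act s z = z) ∧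
      (∀ ζ : π.H, (∀ s, π.act s ζ = ζ) → inner ℂ ζ x = inner ℂ ζ z) ∧
      ∀ (y : π.H) (c : ℝ), (∀ s, ‖inner ℂ (π.act s x) y‖ ≤ c) → ‖inner ℂ z y‖ ≤ c :=
  ⟨π.invariants.starProjection x, Submodule.starProjection_apply_mem π.invariants _,
    fun _ hζ => (π.inner_invariants_proj hζ _).symm,
    fun _ _ h => π.norm_inner_invariants_proj_le _ _ h⟩

/-- A representation with cyclic vector `ξ` whose coefficient is the complex conjugate of that
of `η` is contained in the dual. -/
theorem UnitaryRep.isSubrep_dual_of_coeff_eq {ρ π : UnitaryRep Γ} {ξ : ρ.H} {η : π.H}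
    (h : DenseRange (ρ.orbitMap ξ)) (hc : ∀ γ, ρ.coeff ξ γ = conj (π.coeff η γ)) :
    ρ.IsSubrep π.dual := by
  refine isSubrep_of_coeff_eq (π := π.dual) (η := InnerProductSpace.toDual ℂ π.H η) h fun γ => ?_
  have h1 : (InnerProductSpace.toDual ℂ π.H η).comp (π.act γ⁻¹ : π.H →L[ℂ] π.H) =
      InnerProductSpace.toDual ℂ π.H (π.act γ η) := by
    ext x
    change inner ℂ η (π.act γ⁻¹ x) = inner ℂ (π.act γ η) x
    rw [inner_act_left]
  have h2 : π.dual.coeff (InnerProductSpace.toDual ℂ π.H η) γ =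
      inner ℂ ((InnerProductSpace.toDual ℂ π.H).symm
        ((InnerProductSpace.toDual ℂ π.H η).comp (π.act γ⁻¹ : π.H →L[ℂ] π.H)))
        ((InnerProductSpace.toDual ℂ π.H).symm (InnerProductSpace.toDual ℂ π.H η)) := rfl
  rw [hc, h2, h1, LinearIsometryEquiv.symm_apply_apply, LinearIsometryEquiv.symm_apply_apply,
    coeff, inner_conj_symm]

theorem gnsConj_mem {R : Set (UnitaryRep Γ)} (hR : IsHereditary R) {φ : Γ → ℂ}
    (hφ : φ ∈ traceSet Γ) (h : gnsRep φ hφ ∈ R) : gnsConj φ hφ ∈ R := by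
  refine hR.diagonal_closed _ ?_ ?_
  · refine hR.subrep_closed _ h _ ⟨LinearIsometry.id, fun γ x => ?_⟩
    exact congrArg ((gnsRep φ hφ).act γ) (rightTranslation_one φ hφ x)
  · refine hR.subrep_closed _ (hR.dual_closed _ h) _ ?_
    refine UnitaryRep.isSubrep_dual_of_coeff_eq (ρ := (gnsBi φ hφ).comap (MonoidHom.inr Γ Γ))
      (ξ := gnsVec φ hφ) (η := gnsVec φ hφ) ?_ fun γ => ?_
    · -- the right translates of `v_φ` are its left translates in a different order
      refine (gnsRep_denseRange φ hφ).mono ?_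
      rintro _ ⟨x, rfl⟩
      have h1 (a : Γ) : ((gnsBi φ hφ).comap (MonoidHom.inr Γ Γ)).act a⁻¹ (gnsVec φ hφ) =
          gnsDelta φ hφ a := by
        have := gnsBiAct_gnsDelta φ hφ 1 a⁻¹ 1
        rw [gnsDelta_one, one_mul, one_mul, inv_inv] at this
        exact this
      refine ⟨x.mapDomain (·⁻¹), ?_⟩
      refine (Finsupp.linearCombination_mapDomain ℂ _ _).trans ?_
      exact Finsupp.sum_congr fun a _ => congrArg (fun y : (gnsRep φ hφ).H => x a • y) (h1 a)
    · rw [gnsRep_coeff, ← hφ.1.map_inv]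
      have := gnsBiAct_gnsDelta φ hφ 1 γ 1
      rw [gnsDelta_one] at this
      change inner ℂ (gnsVec φ hφ) (gnsBiAct φ hφ (1, γ) (gnsVec φ hφ)) = _
      rw [this, ← gnsDelta_one, inner_gnsDelta]
      simp

/-! ### Class functions dominated by a character -/

theorem inner_sum_gnsDelta (φ : Γ → ℂ) (hφ : φ ∈ traceSet Γ) {n : ℕ} (γ : Fin n → Γ)
    (α : Fin n → ℂ) : ∑ i, ∑ j, α i * conj (α j) * φ ((γ j)⁻¹ * γ i) =
      (‖∑ i, α i • gnsDelta φ hφ (γ i)‖ ^ 2 : ℝ) := by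
  have := inner_self_eq_norm_sq_to_K (𝕜 := ℂ) (∑ i, α i • gnsDelta φ hφ (γ i))
  rw [Complex.ofReal_pow]
  refine Eq.trans ?_ this
  simp only [sum_inner, inner_sum, inner_smul_left, inner_smul_right, inner_gnsDelta,
    Finset.mul_sum]
  exact Finset.sum_congr rfl fun a _ => Finset.sum_congr rfl fun b _ => by ring

theorem conj_form_eq (f : Γ → ℂ) {n : ℕ} (γ : Fin n → Γ) (α : Fin n → ℂ) :
    ∑ i, ∑ j, α i * conj (α j) * conj (f ((γ j)⁻¹ * γ i)⁻¹) =
      conj (∑ i, ∑ j, α i * conj (α j) * f ((γ j)⁻¹ * γ i)) := by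
  simp only [map_sum, map_mul, Complex.conj_conj, mul_inv_rev, inv_inv]
  rw [Finset.sum_comm]
  exact Finset.sum_congr rfl fun a _ => Finset.sum_congr rfl fun b _ => by ring

/-- A small hermitian class function dominated by the trace `ψ` can be added to `ψ`. -/
theorem add_smul_mem_traceSet {ψ : Γ → ℂ} (hψ : ψ ∈ traceSet Γ) {g : Γ → ℂ}
    (hg : ∀ x γ : Γ, g (x⁻¹ * γ * x) = g γ) (hs : ∀ γ, g γ⁻¹ = conj (g γ)) {t : ℝ}
    (hb : ∀ (n : ℕ) (γ : Fin n → Γ) (α : Fin n → ℂ),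
      |t| * ‖∑ i, ∑ j, α i * conj (α j) * g ((γ j)⁻¹ * γ i)‖ ≤
        ‖∑ i, α i • gnsDelta ψ hψ (γ i)‖ ^ 2) {r : ℝ} (hr : g 1 = r) (ht : 0 < 1 + t * r) :
    (fun γ => ((1 + t * r : ℝ)⁻¹ : ℂ) * (ψ γ + t * g γ)) ∈ traceSet Γ := by
  refine ⟨fun n γ α => ?_, fun x γ => ?_, ?_⟩
  · have h1 : ∑ i, ∑ j, α i * conj (α j) *
        (((1 + t * r : ℝ)⁻¹ : ℂ) * (ψ ((γ j)⁻¹ * γ i) + t * g ((γ j)⁻¹ * γ i))) =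
        ((1 + t * r : ℝ)⁻¹ : ℂ) * (∑ i, ∑ j, α i * conj (α j) * ψ ((γ j)⁻¹ * γ i) +
          t * ∑ i, ∑ j, α i * conj (α j) * g ((γ j)⁻¹ * γ i)) := by
      simp only [mul_add, Finset.sum_add_distrib, Finset.mul_sum]
      congr 1 <;>
      exact Finset.sum_congr rfl fun a _ => Finset.sum_congr rfl fun b _ => by ring
    rw [h1, inner_sum_gnsDelta ψ hψ]
    set F := ∑ i, ∑ j, α i * conj (α j) * g ((γ j)⁻¹ * γ i) with hF
    have h2 : conj F = F := by
      rw [hF, ← conj_form_eq]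
      simp only [hs, Complex.conj_conj]
    obtain ⟨y, hy⟩ : ∃ y : ℝ, F = y := (Complex.conj_eq_iff_real).1 h2
    have h3 := hb n γ α
    rw [← hF, hy, Complex.norm_real, Real.norm_eq_abs, ← abs_mul] at h3
    rw [hy]
    norm_cast
    have := neg_abs_le (t * y)
    refine mul_nonneg (inv_nonneg.2 ht.le) (by linarith)
  · simp only [hψ.2.1, hg]
  · simp only [hψ.2.2, hr]
    norm_cast
    exact inv_mul_cancel₀ ht.ne'

/-- The hermitian case of the minimality of characters: `ψ` lies between the normalizations of
`ψ + t g` and `ψ - t g` for small `t`, and both are traces. -/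
theorem eq_mul_of_hermitian_of_bounded {ψ : Γ → ℂ} (hψ : ψ ∈ charSet Γ) {g : Γ → ℂ}
    (hg : ∀ x γ : Γ, g (x⁻¹ * γ * x) = g γ) (hs : ∀ γ, g γ⁻¹ = conj (g γ)) {C : ℝ}
    (hb : ∀ (n : ℕ) (γ : Fin n → Γ) (α : Fin n → ℂ),
      ‖∑ i, ∑ j, α i * conj (α j) * g ((γ j)⁻¹ * γ i)‖ ≤
        C * ‖∑ i, α i • gnsDelta ψ (charSet_subset hψ) (γ i)‖ ^ 2) (γ : Γ) :
    g γ = g 1 * ψ γ := by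
  have hψ' := charSet_subset hψ
  obtain ⟨r, hr⟩ : ∃ r : ℝ, g 1 = r := (Complex.conj_eq_iff_real).1 (by rw [← hs, inv_one])
  have hrC : |r| ≤ C := by
    have := hb 1 ![1] ![1]
    simpa [hr, norm_gnsDelta] using this
  obtain ⟨t, ht0, ht⟩ : ∃ t : ℝ, 0 < t ∧ t * C < 1 := by
    have hC : 0 ≤ C := (abs_nonneg r).trans hrC
    refine ⟨(C + 1)⁻¹, by positivity, ?_⟩
    rw [inv_mul_lt_iff₀ (by positivity)]
    linarith
  have htr : |t * r| < 1 := by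
    rw [abs_mul, abs_of_pos ht0]
    exact (mul_le_mul_of_nonneg_left hrC ht0.le).trans_lt ht
  have hb' (t' : ℝ) (h : |t'| = t) (n : ℕ) (γ : Fin n → Γ) (α : Fin n → ℂ) :
      |t'| * ‖∑ i, ∑ j, α i * conj (α j) * g ((γ j)⁻¹ * γ i)‖ ≤
        ‖∑ i, α i • gnsDelta ψ hψ' (γ i)‖ ^ 2 := by
    rw [h]
    refine (mul_le_mul_of_nonneg_left (hb n γ α) ht0.le).trans ?_
    rw [← mul_assoc]
    exact mul_le_of_le_one_left (sq_nonneg _) ht.le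
  have hp : 0 < 1 + t * r := by linarith [(abs_lt.1 htr).1]
  have hm : 0 < 1 + -t * r := by linarith [(abs_lt.1 htr).2]
  have h1 := add_smul_mem_traceSet hψ' hg hs (hb' t (abs_of_pos ht0)) hr hp
  have h2 := add_smul_mem_traceSet hψ' hg hs (hb' (-t) (by rw [abs_neg, abs_of_pos ht0])) hr hm
  have h3 := (mem_extremePoints.1 hψ).2 _ h1 _ h2
    ⟨(1 + t * r) / 2, (1 + -t * r) / 2, by positivity, by positivity, by ring, by
      funext x
      have e1 : ((1 + t * r : ℝ) : ℂ) ≠ 0 := by exact_mod_cast hp.ne'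
      have e2 : ((1 + -t * r : ℝ) : ℂ) ≠ 0 := by exact_mod_cast hm.ne'
      simp only [Pi.add_apply, Pi.smul_apply, Complex.real_smul, Complex.ofReal_div]
      calc _ = (((1 + t * r : ℝ) : ℂ) * ((1 + t * r : ℝ) : ℂ)⁻¹) * ((ψ x + t * g x) / 2) +
            (((1 + -t * r : ℝ) : ℂ) * ((1 + -t * r : ℝ) : ℂ)⁻¹) * ((ψ x + (-t : ℝ) * g x) / 2) := by
            push_cast; ring
        _ = ψ x := by
            rw [mul_inv_cancel₀ e1, mul_inv_cancel₀ e2]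
            push_cast
            ring⟩
  have h4 := congrFun h3.1 γ
  have e1 : ((1 + t * r : ℝ) : ℂ) ≠ 0 := by exact_mod_cast hp.ne'
  have e3 : (t : ℂ) ≠ 0 := by exact_mod_cast ht0.ne'
  rw [inv_mul_eq_iff_eq_mul₀ e1] at h4
  rw [hr]
  apply mul_left_cancel₀ e3
  push_cast at h4
  linear_combination h4

/-- Characters are minimal among class functions: a class function whose hermitian form is bounded
by that of a character is a multiple of it. -/
theorem eq_mul_of_bounded {ψ : Γ → ℂ} (hψ : ψ ∈ charSet Γ) {f : Γ → ℂ}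
    (hf : ∀ x γ : Γ, f (x⁻¹ * γ * x) = f γ) {C : ℝ}
    (hb : ∀ (n : ℕ) (γ : Fin n → Γ) (α : Fin n → ℂ),
      ‖∑ i, ∑ j, α i * conj (α j) * f ((γ j)⁻¹ * γ i)‖ ≤
        C * ‖∑ i, α i • gnsDelta ψ (charSet_subset hψ) (γ i)‖ ^ 2) (γ : Γ) :
    f γ = f 1 * ψ γ := by
  have hf' (x γ : Γ) : f (x⁻¹ * γ * x)⁻¹ = f γ⁻¹ := by
    rw [← hf x γ⁻¹]; congr 1; group
  have h1 := eq_mul_of_hermitian_of_bounded hψ (g := fun γ => f γ + conj (f γ⁻¹)) (C := 2 * C)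
    (fun x γ => by simp only [hf, hf']) (fun γ => by simp [add_comm]) (fun n γ α => by
      have e : ∑ i, ∑ j, α i * conj (α j) * (f ((γ j)⁻¹ * γ i) + conj (f ((γ j)⁻¹ * γ i)⁻¹)) =
          ∑ i, ∑ j, α i * conj (α j) * f ((γ j)⁻¹ * γ i) +
            conj (∑ i, ∑ j, α i * conj (α j) * f ((γ j)⁻¹ * γ i)) := by
        rw [← conj_form_eq]
        simp only [mul_add, Finset.sum_add_distrib]
      rw [e]
      refine (norm_add_le _ _).trans ?_
      rw [RCLike.norm_conj]
      linarith [hb n γ α]) γ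
  have h2 := eq_mul_of_hermitian_of_bounded hψ
    (g := fun γ => Complex.I * (f γ - conj (f γ⁻¹))) (C := 2 * C)
    (fun x γ => by simp only [hf, hf'])
    (fun γ => by simp only [map_mul, map_sub, Complex.conj_I, Complex.conj_conj, inv_inv]; ring)
    (fun n γ α => by
      have e : ∑ i, ∑ j, α i * conj (α j) *
          (Complex.I * (f ((γ j)⁻¹ * γ i) - conj (f ((γ j)⁻¹ * γ i)⁻¹))) =
          Complex.I * (∑ i, ∑ j, α i * conj (α j) * f ((γ j)⁻¹ * γ i) -
            conj (∑ i, ∑ j, α i * conj (α j) * f ((γ j)⁻¹ * γ i))) := by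
        rw [← conj_form_eq]
        simp only [mul_sub, Finset.sum_sub_distrib, Finset.mul_sum]
        congr 1 <;>
        exact Finset.sum_congr rfl fun a _ => Finset.sum_congr rfl fun b _ => by ring
      rw [e, norm_mul, Complex.norm_I, one_mul]
      refine (norm_sub_le _ _).trans ?_
      rw [RCLike.norm_conj]
      linarith [hb n γ α]) γ
  simp only [inv_one] at h1 h2
  linear_combination (h1 - Complex.I * h2) / 2 + (1 / 2) *
    (f γ - conj (f γ⁻¹) - (f 1 - conj (f 1)) * ψ γ) * Complex.I_sq

/-- The mean of the conjugates of `g v_ψ` is a multiple of `v_ψ` if `ψ` is a character. -/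
theorem exists_inner_gnsDelta_eq {ψ : Γ → ℂ} (hψ : ψ ∈ charSet Γ) (hψ' : ψ ∈ traceSet Γ) (g : Γ) :
    ∃ c : ℂ, ∀ ζ : (gnsRep ψ hψ').H, (∀ s, gnsBiAct ψ hψ' (s, s) ζ = ζ) →
      inner ℂ ζ (gnsDelta ψ hψ' g) = c * inner ℂ ζ (gnsVec ψ hψ') := by
  obtain ⟨z, hzinv, hzinner, hznorm⟩ : ∃ z : (gnsRep ψ hψ').H,
      (∀ s, gnsBiAct ψ hψ' (s, s) z = z) ∧
      (∀ ζ : (gnsRep ψ hψ').H, (∀ s, gnsBiAct ψ hψ' (s, s) ζ = ζ) →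
        inner ℂ ζ (gnsDelta ψ hψ' g) = inner ℂ ζ z) ∧
      ∀ (y : (gnsRep ψ hψ').H) (c : ℝ),
        (∀ s, ‖inner ℂ (gnsBiAct ψ hψ' (s, s) (gnsDelta ψ hψ' g)) y‖ ≤ c) → ‖inner ℂ z y‖ ≤ c :=
    (gnsConj ψ hψ').exists_mean (gnsDelta ψ hψ' g)
  have hclass (x γ : Γ) : inner ℂ z (gnsDelta ψ hψ' (x * γ * x⁻¹)) =
      inner ℂ z (gnsDelta ψ hψ' γ) := by
    rw [← gnsBiAct_gnsDelta]
    nth_rewrite 1 [← hzinv x]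
    rw [LinearIsometryEquiv.inner_map_map]
  have hz := eq_mul_of_bounded hψ (f := fun γ => inner ℂ z (gnsDelta ψ hψ' γ)) (C := 1)
    (fun x γ => by simpa using hclass x⁻¹ γ)
    (fun n γ α => by
      set x := ∑ i, α i • gnsDelta ψ hψ' (γ i) with hx
      have h1 := hznorm (∑ i, ∑ j, (α i * conj (α j)) • gnsDelta ψ hψ' (γ i * (γ j)⁻¹))
        (1 * ‖x‖ ^ 2) fun s => by
          have h2 : inner ℂ (gnsBiAct ψ hψ' (s, s) (gnsDelta ψ hψ' g))
              (∑ i, ∑ j, (α i * conj (α j)) • gnsDelta ψ hψ' (γ i * (γ j)⁻¹)) =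
              inner ℂ ((gnsRep ψ hψ').act (s * g * s⁻¹) x) x := by
            rw [gnsBiAct_gnsDelta, hx]
            simp only [map_sum, map_smul, sum_inner, inner_sum, inner_smul_left,
              inner_smul_right, act_gnsDelta, inner_gnsDelta, Finset.mul_sum]
            refine Finset.sum_congr rfl fun i _ => Finset.sum_congr rfl fun j _ => ?_
            rw [mul_assoc, ← mul_assoc _ (γ i) (γ j)⁻¹, trace_mul_comm hψ' _ (γ j)⁻¹,
              mul_inv_rev _ (γ j), mul_assoc (γ j)⁻¹]
          rw [h2]
          refine (norm_inner_le_norm _ _).trans_eq ?_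
          rw [LinearIsometryEquiv.norm_map]
          ring
      refine Eq.trans_le ?_ h1
      congr 1
      simp only [inner_sum, inner_smul_right]
      refine Finset.sum_congr rfl fun i _ => Finset.sum_congr rfl fun j _ => ?_
      rw [← hclass (γ j), mul_inv_cancel_left])
  refine ⟨conj (inner ℂ z (gnsDelta ψ hψ' 1)), fun ζ hζ => ?_⟩
  have hzv : z = conj (inner ℂ z (gnsDelta ψ hψ' 1)) • gnsVec ψ hψ' := by
    rw [← sub_eq_zero]
    refine UnitaryRep.eq_zero_of_cyclic (gnsRep_denseRange ψ hψ') fun γ => ?_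
    rw [inner_sub_left, inner_smul_left, Complex.conj_conj, ← gnsDelta_one ψ hψ', act_gnsDelta,
      mul_one, hz γ, inner_gnsDelta, inv_one, one_mul, sub_self]
  rw [hzinner ζ hζ]
  nth_rewrite 1 [hzv]
  rw [inner_smul_right]

theorem gnsBiAct_diag_gnsVec (φ : Γ → ℂ) (hφ : φ ∈ traceSet Γ) (s : Γ) :
    gnsBiAct φ hφ (s, s) (gnsVec φ hφ) = gnsVec φ hφ := by
  rw [← gnsDelta_one, gnsBiAct_gnsDelta, mul_one, mul_inv_cancel]

/-- The vectors invariant under conjugation are the multiples of `v_ψ` if `ψ` is a character. -/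
theorem eq_smul_gnsVec_of_conj_invariant {ψ : Γ → ℂ} (hψ : ψ ∈ charSet Γ)
    (hψ' : ψ ∈ traceSet Γ) {ξ : (gnsRep ψ hψ').H} (hξ : ∀ s, gnsBiAct ψ hψ' (s, s) ξ = ξ) :
    ξ = inner ℂ (gnsVec ψ hψ') ξ • gnsVec ψ hψ' := by
  rw [← sub_eq_zero]
  refine UnitaryRep.eq_zero_of_cyclic (gnsRep_denseRange ψ hψ') fun γ => ?_
  obtain ⟨c, hc⟩ := exists_inner_gnsDelta_eq hψ hψ' γ
  refine (hc _ fun s => ?_).trans ?_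
  · rw [map_sub, map_smul, hξ, gnsBiAct_diag_gnsVec]
  · rw [inner_sub_left, inner_smul_left, inner_conj_symm, inner_self_eq_norm_sq_to_K,
      norm_gnsVec]
    simp

/-! ### The mean of the squared modulus of a character -/

theorem IsPosDefFun.posSemidef {φ : Γ → ℂ} (h : IsPosDefFun φ) :
    (Matrix.of fun a b : Γ => φ (a⁻¹ * b)).PosSemidef := by
  refine ⟨?_, fun x => ?_⟩
  · ext a b
    rw [Matrix.conjTranspose_apply, Matrix.of_apply, Matrix.of_apply]
    change conj _ = _
    rw [← h.map_inv, mul_inv_rev, inv_inv]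
  · refine (h.sum_nonneg x).trans_eq ?_
    refine Finsupp.sum_congr fun a _ => Finsupp.sum_congr fun b _ => ?_
    simp only [Matrix.of_apply]
    change conj _ * _ * _ = conj _ * _ * _
    ring

theorem isPosDefFun_of_posSemidef {φ : Γ → ℂ}
    (h : (Matrix.of fun a b : Γ => φ (a⁻¹ * b)).PosSemidef) : IsPosDefFun φ := by
  intro n γ α
  refine ((h.submatrix γ).dotProduct_mulVec_nonneg α).trans_eq ?_
  simp only [dotProduct, Matrix.mulVec, Matrix.submatrix_apply, Matrix.of_apply, Finset.mul_sum,
    Pi.star_apply]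
  rw [Finset.sum_comm]
  refine Finset.sum_congr rfl fun i _ => Finset.sum_congr rfl fun j _ => ?_
  change conj _ * _ = _
  ring

/-- The trace `ψ ⊗ ψ*` on `Γ × Γ`. Its GNS representation is the representation of `Γ × Γ` on the
tensor product of `π_ψ` and its dual, that is, on Hilbert–Schmidt operators. -/
def tensorTrace (ψ : Γ → ℂ) (p : Γ × Γ) : ℂ := ψ p.1 * conj (ψ p.2)

theorem tensorTrace_mem {ψ : Γ → ℂ} (hψ : ψ ∈ traceSet Γ) :
    tensorTrace ψ ∈ traceSet (Γ × Γ) := by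
  refine ⟨isPosDefFun_of_posSemidef ?_, fun x γ => ?_, ?_⟩
  · have h1 := hψ.1.posSemidef.submatrix (Prod.fst : Γ × Γ → Γ)
    have h2 := hψ.1.posSemidef.transpose.submatrix (Prod.snd : Γ × Γ → Γ)
    have h3 : (Matrix.of fun a b : Γ × Γ => tensorTrace ψ (a⁻¹ * b)) =
        ((Matrix.of fun a b : Γ => ψ (a⁻¹ * b)).submatrix Prod.fst Prod.fst).hadamard
          ((Matrix.of fun a b : Γ => ψ (a⁻¹ * b)).transpose.submatrix Prod.snd Prod.snd) := by
      ext a b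
      simp [tensorTrace, ← hψ.1.map_inv]
    rw [h3]
    exact h1.hadamard h2
  · simp only [tensorTrace, Prod.fst_mul, Prod.snd_mul, Prod.fst_inv, Prod.snd_inv, hψ.2.1]
  · simp [tensorTrace, hψ.2.2]

/-- The mean of the cyclic vector of `ψ ⊗ ψ*` under the left translations by the diagonal is
invariant under the right translations by the diagonal, too. -/
theorem tensorTrace_mean_right_invariant {ψ : Γ → ℂ} (hΨ : tensorTrace ψ ∈ traceSet (Γ × Γ))
    {z : (gnsRep (tensorTrace ψ) hΨ).H}
    (hz : ∀ s : Γ, (gnsRep (tensorTrace ψ) hΨ).act (s, s) z = z)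
    (hw : ∀ ζ, (∀ s : Γ, (gnsRep (tensorTrace ψ) hΨ).act (s, s) ζ = ζ) →
      inner ℂ ζ (gnsVec (tensorTrace ψ) hΨ) = inner ℂ ζ z) (k : Γ) :
    rightTranslation (tensorTrace ψ) hΨ (k, k) z = z := by
  set Ψ := tensorTrace ψ
  set ρ := rightTranslation Ψ hΨ
  have hinv (k s : Γ) (ζ : (gnsRep Ψ hΨ).H) (hζ : ∀ s : Γ, (gnsRep Ψ hΨ).act (s, s) ζ = ζ) :
      (gnsRep Ψ hΨ).act (s, s) (ρ (k, k) ζ) = ρ (k, k) ζ := by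
    rw [← rightTranslation_act, hζ]
  have hcancel (ζ : (gnsRep Ψ hΨ).H) : ρ (k, k) (ρ (k⁻¹, k⁻¹) ζ) = ζ := by
    rw [← rightTranslation_mul, Prod.mk_mul_mk, mul_inv_cancel, ← Prod.one_eq_mk,
      rightTranslation_one]
  -- the right translate of `z` has the same inner products with invariant vectors as `z`,
  -- because the right translate of the cyclic vector is a left translate of it
  have key (ζ : (gnsRep Ψ hΨ).H) (hζ : ∀ s : Γ, (gnsRep Ψ hΨ).act (s, s) ζ = ζ) :
      inner ℂ ζ (ρ (k, k) z) = inner ℂ ζ z := by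
    have h1 : ρ (k, k) (gnsVec Ψ hΨ) = (gnsRep Ψ hΨ).act (k⁻¹, k⁻¹) (gnsVec Ψ hΨ) := by
      rw [← gnsDelta_one, rightTranslation_gnsDelta, act_gnsDelta, one_mul, mul_one]; rfl
    calc inner ℂ ζ (ρ (k, k) z) = inner ℂ (ρ (k⁻¹, k⁻¹) ζ) z := by
          rw [← hcancel ζ, (ρ (k, k)).inner_map_map, hcancel]
      _ = inner ℂ (ρ (k⁻¹, k⁻¹) ζ) (gnsVec Ψ hΨ) := (hw _ fun s => hinv _ _ _ hζ).symm
      _ = inner ℂ ζ ((gnsRep Ψ hΨ).act (k⁻¹, k⁻¹) (gnsVec Ψ hΨ)) := by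
          rw [← h1, ← (ρ (k, k)).inner_map_map, hcancel]
      _ = inner ℂ ζ (gnsVec Ψ hΨ) := by
          rw [← hζ k⁻¹, UnitaryRep.inner_act_act, hζ]
      _ = inner ℂ ζ z := hw ζ hζ
  rw [← sub_eq_zero, ← inner_self_eq_zero (𝕜 := ℂ)]
  have h2 : ∀ s : Γ, (gnsRep Ψ hΨ).act (s, s) (ρ (k, k) z - z) = ρ (k, k) z - z := fun s => by
    rw [map_sub, hinv k s z hz, hz]
  rw [inner_sub_right, key _ h2, sub_self]

/-- For a character `ψ` there is a number `m`, the mean of `|ψ|²` over `Γ`, that is bounded by the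
inverse of the dimension of the GNS representation, and bounded below by every lower bound of the
convex combinations of the translates of `|ψ|²`. In the space of Hilbert–Schmidt operators, `m` is
the squared norm of the projection of the rank one operator `v_ψ ⊗ v_ψ*` onto the operators
commuting with `Γ`; this projection commutes with the right translations, too, and so it is `m`
times the identity. -/
theorem exists_mean_normSq {ψ : Γ → ℂ} (hψ : ψ ∈ charSet Γ) (hψ' : ψ ∈ traceSet Γ) :
    ∃ m : ℝ, (∀ (n : ℕ) (y : Fin n → Γ →₀ ℂ),
        Orthonormal ℂ (fun j => (gnsRep ψ hψ').orbitMap (gnsVec ψ hψ') (y j)) → n * m ≤ 1) ∧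
      ∀ b : ℝ, (∀ (ι : Type) (_ : Fintype ι) (w : ι → ℝ) (h : ι → Γ), (∀ i, 0 ≤ w i) →
        ∑ i, w i = 1 → b ≤ ∑ i, ∑ j, w i * w j * ‖ψ ((h i)⁻¹ * h j)‖ ^ 2) → b ≤ m := by
  have hΨ := tensorTrace_mem hψ'
  set Ψ := tensorTrace ψ with hΨdef
  let π : UnitaryRep Γ := (gnsRep Ψ hΨ).comap ((MonoidHom.id Γ).prod (MonoidHom.id Γ))
  let w : (gnsRep Ψ hΨ).H := gnsVec Ψ hΨ
  let z : (gnsRep Ψ hΨ).H := π.invariants.starProjection w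
  let δ : Γ → Γ → (gnsRep Ψ hΨ).H := fun a b => gnsDelta Ψ hΨ (a, b)
  have hz : ∀ s : Γ, (gnsRep Ψ hΨ).act (s, s) z = z :=
    Submodule.starProjection_apply_mem π.invariants w
  have hzw : ∀ ζ : (gnsRep Ψ hΨ).H, (∀ s : Γ, (gnsRep Ψ hΨ).act (s, s) ζ = ζ) →
      inner ℂ ζ w = inner ℂ ζ z := fun ζ hζ => (π.inner_invariants_proj hζ w).symm
  have hznorm (y : (gnsRep Ψ hΨ).H) (c : ℝ) (h : ∀ s, ‖inner ℂ (δ s s) y‖ ≤ c) :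
      ‖inner ℂ z y‖ ≤ c := π.norm_inner_invariants_proj_le w y h
  have hact (s a b : Γ) : (gnsRep Ψ hΨ).act (s, s) (δ a b) = δ (s * a) (s * b) :=
    act_gnsDelta Ψ hΨ _ _
  have hδ (a b c d : Γ) : inner ℂ (δ a b) (δ c d) = ψ (a⁻¹ * c) * conj (ψ (b⁻¹ * d)) :=
    inner_gnsDelta Ψ hΨ _ _
  have hzδ (a b : Γ) : inner ℂ z (δ a b) = inner ℂ z (δ (b⁻¹ * a) 1) := by
    rw [← (gnsRep Ψ hΨ).inner_act_act (b⁻¹, b⁻¹), hz, hact, inv_mul_cancel]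
  have hzr := tensorTrace_mean_right_invariant hΨ hz hzw
  have hclass (k g : Γ) : inner ℂ z (δ (k * g * k⁻¹) 1) = inner ℂ z (δ g 1) := by
    rw [← (rightTranslation Ψ hΨ (k⁻¹, k⁻¹)).inner_map_map, hzr]
    rw [← (gnsRep Ψ hΨ).inner_act_act (k⁻¹, k⁻¹), hz, rightTranslation_gnsDelta, act_gnsDelta]
    congr 2
    ext <;> simp [mul_assoc]
  have hf := eq_mul_of_bounded hψ (f := fun g => inner ℂ z (δ g 1)) (C := 1)
    (fun x γ => by simpa using hclass x⁻¹ γ)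
    (fun n γ α => by
      set x := ∑ i, α i • gnsDelta ψ hψ' (γ i) with hx
      have h1 := hznorm (∑ i, ∑ j, (α i * conj (α j)) • δ (γ i) (γ j)) (1 * ‖x‖ ^ 2) fun s => by
        have h2 : inner ℂ (δ s s) (∑ i, ∑ j, (α i * conj (α j)) • δ (γ i) (γ j)) =
            inner ℂ (gnsDelta ψ hψ' s) x * conj (inner ℂ (gnsDelta ψ hψ' s) x) := by
          rw [hx]
          simp only [inner_sum, inner_smul_right, inner_gnsDelta, hδ, map_sum, Finset.sum_mul_sum,
            map_mul]
          exact Finset.sum_congr rfl fun i _ => Finset.sum_congr rfl fun j _ => by ring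
        rw [h2, norm_mul, RCLike.norm_conj, one_mul, ← sq]
        have := norm_inner_le_norm (𝕜 := ℂ) (gnsDelta ψ hψ' s) x
        rw [norm_gnsDelta, one_mul] at this
        gcongr
      refine Eq.trans_le ?_ h1
      congr 1
      simp only [inner_sum, inner_smul_right]
      exact Finset.sum_congr rfl fun i _ => Finset.sum_congr rfl fun j _ => by rw [hzδ (γ i)])
  have hm : inner ℂ z (δ 1 1) = ((‖z‖ ^ 2 : ℝ) : ℂ) := by
    have h1 : inner ℂ z (δ 1 1) = inner ℂ z z := by
      rw [← hzw z hz]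
      exact congrArg _ (gnsDelta_one Ψ hΨ)
    rw [h1, inner_self_eq_norm_sq_to_K]
    norm_cast
  refine ⟨‖z‖ ^ 2, fun n y hy => ?_, fun b hb => ?_⟩
  · let v := gnsVec ψ hψ'
    -- `Y` is the projection onto the span of the orthonormal vectors `y j v_ψ`, seen as a
    -- Hilbert–Schmidt operator
    let Y : (gnsRep Ψ hΨ).H := ∑ j, (y j).sum fun b β => (y j).sum fun a α => (conj β * α) • δ a b
    have h1 : ∀ s, (inner ℂ (δ s s) Y).re ≤ 1 := fun s => by
      have h2 : inner ℂ (δ s s) Y =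
          ∑ j, ((‖inner ℂ ((gnsRep ψ hψ').orbitMap v (y j)) (gnsDelta ψ hψ' s)‖ ^ 2 : ℝ) : ℂ) := by
        simp only [Y, inner_sum, Finsupp.sum]
        refine Finset.sum_congr rfl fun j _ => ?_
        rw [Complex.ofReal_pow, ← Complex.mul_conj', inner_conj_symm]
        have h3 : inner ℂ (gnsDelta ψ hψ' s) ((gnsRep ψ hψ').orbitMap v (y j)) =
            ∑ a ∈ (y j).support, y j a * ψ (s⁻¹ * a) := by
          rw [UnitaryRep.orbitMap_apply, Finsupp.sum, inner_sum]
          refine Finset.sum_congr rfl fun a _ => ?_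
          rw [inner_smul_right, ← inner_gnsDelta ψ hψ']
          rfl
        rw [← inner_conj_symm, h3, map_sum, Finset.sum_mul_sum]
        refine Finset.sum_congr rfl fun b _ => Finset.sum_congr rfl fun a _ => ?_
        rw [inner_smul_right, hδ, map_mul]
        ring
      rw [h2, ← Complex.ofReal_sum, Complex.ofReal_re]
      refine (hy.sum_inner_products_le _).trans_eq ?_
      rw [norm_gnsDelta, one_pow]
    have h4 : (inner ℂ z Y).re ≤ 1 := π.re_inner_invariants_proj_le w Y h1
    have h5 : inner ℂ z Y = ((n * ‖z‖ ^ 2 : ℝ) : ℂ) := by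
      have h6 (j : Fin n) : inner ℂ z ((y j).sum fun b β => (y j).sum fun a α =>
          (conj β * α) • δ a b) = ((‖z‖ ^ 2 : ℝ) : ℂ) := by
        have h7 := (gnsRep ψ hψ').inner_orbitMap v (y j) (y j)
        rw [inner_self_eq_norm_sq_to_K, hy.1 j] at h7
        have h8 : (1 : ℂ) = (y j).sum fun a z => (y j).sum fun b w =>
          conj z * w * (gnsRep ψ hψ').coeff v (a⁻¹ * b) := by
          rw [← h7]; norm_num
        rw [← mul_one ((‖z‖ ^ 2 : ℝ) : ℂ), h8]
        simp only [Finsupp.sum, inner_sum, Finset.mul_sum]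
        refine Finset.sum_congr rfl fun b _ => Finset.sum_congr rfl fun a _ => ?_
        rw [inner_smul_right, hzδ, hf, hm, gnsRep_coeff]
        ring
      simp only [Y, inner_sum, h6]
      simp
    rw [h5, Complex.ofReal_re] at h4
    exact h4
  · have hc : Convex ℝ (closure (convexHull ℝ (Set.range fun s : Γ => δ s s))) :=
      (convex_convexHull ℝ _).closure
    have h1 : z ∈ closure (convexHull ℝ (Set.range fun s : Γ => δ s s)) :=
      have h0 (s : Γ) : δ s s ∈ closure (convexHull ℝ (Set.range fun s : Γ => δ s s)) :=
        subset_closure (subset_convexHull ℝ _ ⟨s, rfl⟩)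
      π.invariants_proj_mem w hc isClosed_closure fun s => by
        have h3 : π.act s w = δ s s := rfl
        rw [h3]
        exact h0 s
    have h2 : closure (convexHull ℝ (Set.range fun s : Γ => δ s s)) ⊆ {x | b ≤ ‖x‖ ^ 2} := by
      refine closure_minimal (fun x hx => ?_) (isClosed_le continuous_const (by fun_prop))
      obtain ⟨ι, _, c, p, hc, hc1, hp, rfl⟩ := mem_convexHull_iff_exists_fintype.1 hx
      choose h hh using hp
      refine (hb ι inferInstance c h hc hc1).trans_eq ?_
      have h3 : ((‖∑ i, c i • p i‖ ^ 2 : ℝ) : ℂ) =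
          ((∑ i, ∑ j, c i * c j * ‖ψ ((h i)⁻¹ * h j)‖ ^ 2 : ℝ) : ℂ) := by
        have h4 := inner_self_eq_norm_sq_to_K (𝕜 := ℂ) (∑ i, c i • p i)
        rw [Complex.ofReal_pow]
        refine h4.symm.trans ?_
        simp only [sum_inner, inner_sum, inner_smul_left_eq_smul, inner_smul_right_eq_smul, ← hh,
          hδ, Complex.real_smul, Complex.mul_conj', Complex.ofReal_sum, Finset.mul_sum]
        rw [Finset.sum_comm]
        refine Finset.sum_congr rfl fun i _ => Finset.sum_congr rfl fun j _ => ?_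
        push_cast
        ring
      exact (Complex.ofReal_injective h3).symm
    exact h2 h1

/-! ### Elements of the group algebra as vectors of the GNS representation -/

/-- The map from the group algebra to the GNS representation that sends `a` to `a v_φ`. -/
noncomputable def gnsMap (φ : Γ → ℂ) (hφ : φ ∈ traceSet Γ) : (Γ →₀ ℂ) →ₗ[ℂ] (gnsRep φ hφ).H :=
  Finsupp.linearCombination ℂ (gnsDelta φ hφ)

theorem gnsMap_single (φ : Γ → ℂ) (hφ : φ ∈ traceSet Γ) (a : Γ) (z : ℂ) :
    gnsMap φ hφ (Finsupp.single a z) = z • gnsDelta φ hφ a := by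
  simp [gnsMap]

/-- The sesquilinear form on the group algebra that is given by a function on the group. -/
noncomputable def groupForm (f : Γ → ℂ) (x y : Γ →₀ ℂ) : ℂ :=
  x.sum fun a z => y.sum fun b w => conj z * w * f (a⁻¹ * b)

theorem inner_gnsMap (φ : Γ → ℂ) (hφ : φ ∈ traceSet Γ) (x y : Γ →₀ ℂ) :
    inner ℂ (gnsMap φ hφ x) (gnsMap φ hφ y) = groupForm φ x y := by
  refine ((gnsRep φ hφ).inner_orbitMap (gnsVec φ hφ) x y).trans ?_
  simp only [gnsRep_coeff]
  rfl

theorem continuous_groupForm (x y : Γ →₀ ℂ) : Continuous fun f : Γ → ℂ => groupForm f x y := by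
  unfold groupForm Finsupp.sum
  fun_prop

/-- A relation that holds in the GNS representation of `φ` holds approximately in those of the
traces near `φ`. -/
theorem eventually_norm_gnsMap_lt {φ : Γ → ℂ} {hφ : φ ∈ traceSet Γ} {x : Γ →₀ ℂ}
    (hx : gnsMap φ hφ x = 0) {ε : ℝ} (hε : 0 < ε) :
    ∀ᶠ ψ in 𝓝 φ, ∀ hψ : ψ ∈ traceSet Γ, ‖gnsMap ψ hψ x‖ < ε := by
  have h0 : groupForm φ x x = 0 := by rw [← inner_gnsMap φ hφ, hx, inner_zero_left]
  have h1 := (continuous_groupForm x x).norm.tendsto φ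
  rw [h0, norm_zero] at h1
  filter_upwards [h1.eventually (gt_mem_nhds (pow_pos hε 2))] with ψ h2 hψ
  rw [← inner_gnsMap ψ hψ, inner_self_eq_norm_sq_to_K] at h2
  refine lt_of_pow_lt_pow_left₀ 2 hε.le (lt_of_eq_of_lt ?_ h2)
  simp

theorem gnsMap_denseRange (φ : Γ → ℂ) (hφ : φ ∈ traceSet Γ) : DenseRange (gnsMap φ hφ) :=
  gnsRep_denseRange φ hφ

theorem gnsMap_surjective {φ : Γ → ℂ} {hφ : φ ∈ traceSet Γ} (h : IsFiniteDimTrace φ hφ) :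
    Function.Surjective (gnsMap φ hφ) := by
  have : FiniteDimensional ℂ (gnsRep φ hφ).H := h
  have h1 : IsClosed ((LinearMap.range (gnsMap φ hφ) : Submodule ℂ _) : Set (gnsRep φ hφ).H) :=
    Submodule.closed_of_finiteDimensional _
  have h2 := (gnsMap_denseRange φ hφ).closure_range
  rw [← LinearMap.coe_range, h1.closure_eq] at h2
  exact Set.range_eq_univ.1 (by rw [← LinearMap.coe_range, h2])

/-- Left translation by `s` on the group algebra. -/
noncomputable def leftMul (s : Γ) : (Γ →₀ ℂ) →ₗ[ℂ] (Γ →₀ ℂ) := Finsupp.lmapDomain ℂ ℂ (s * ·)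

theorem leftMul_single (s a : Γ) (z : ℂ) :
    leftMul s (Finsupp.single a z) = Finsupp.single (s * a) z := by
  simp [leftMul]

theorem gnsMap_leftMul (φ : Γ → ℂ) (hφ : φ ∈ traceSet Γ) (s : Γ) (x : Γ →₀ ℂ) :
    gnsMap φ hφ (leftMul s x) = (gnsRep φ hφ).act s (gnsMap φ hφ x) := by
  induction x using Finsupp.induction_linear with
  | zero => simp
  | add x y hx hy => simp only [map_add, hx, hy]
  | single a z => rw [leftMul_single, gnsMap_single, gnsMap_single, map_smul, act_gnsDelta]

/-- Complex conjugation of the coefficients of an element of the group algebra. -/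
noncomputable def conjCoeff {ι : Type*} : (ι →₀ ℂ) →ₛₗ[starRingEnd ℂ] (ι →₀ ℂ) :=
  Finsupp.mapRange.linearMap (starRingEnd ℂ).toSemilinearMap

theorem conjCoeff_single {ι : Type*} (a : ι) (z : ℂ) :
    conjCoeff (Finsupp.single a z) = Finsupp.single a (conj z) := by
  simp [conjCoeff]

theorem conjCoeff_leftMul (s : Γ) (x : Γ →₀ ℂ) :
    conjCoeff (leftMul s x) = leftMul s (conjCoeff x) := by
  induction x using Finsupp.induction_linear with
  | zero => simp
  | add x y hx hy => simp only [map_add, hx, hy]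
  | single a z => simp only [leftMul_single, conjCoeff_single]

/-- The vector `p h q° v_φ`, where `q ↦ q°` is the linear extension of the inversion of `Γ`. -/
noncomputable def sandwich (φ : Γ → ℂ) (hφ : φ ∈ traceSet Γ) (h : Γ) :
    (Γ →₀ ℂ) →ₗ[ℂ] (Γ →₀ ℂ) →ₗ[ℂ] (gnsRep φ hφ).H :=
  Finsupp.linearCombination ℂ fun a =>
    Finsupp.linearCombination ℂ fun b => gnsDelta φ hφ (a * h * b⁻¹)

theorem sandwich_single (φ : Γ → ℂ) (hφ : φ ∈ traceSet Γ) (h a b : Γ) (z w : ℂ) :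
    sandwich φ hφ h (Finsupp.single a z) (Finsupp.single b w) =
      (z * w) • gnsDelta φ hφ (a * h * b⁻¹) := by
  simp [sandwich, mul_smul]

theorem gnsBiAct_sandwich (φ : Γ → ℂ) (hφ : φ ∈ traceSet Γ) (h s : Γ) (p q : Γ →₀ ℂ) :
    gnsBiAct φ hφ (s, s) (sandwich φ hφ h p q) = sandwich φ hφ h (leftMul s p) (leftMul s q) := by
  induction p using Finsupp.induction_linear with
  | zero => simp
  | add x y hx hy => simp only [map_add, LinearMap.add_apply, hx, hy]
  | single a z =>
    induction q using Finsupp.induction_linear with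
    | zero => simp
    | add x y hx hy => simp only [map_add, hx, hy]
    | single b w =>
      simp only [leftMul_single, sandwich_single, map_smul, gnsBiAct_gnsDelta, mul_inv_rev,
        mul_assoc]

theorem sandwich_eq_left (φ : Γ → ℂ) (hφ : φ ∈ traceSet Γ) (h : Γ) (p q : Γ →₀ ℂ) :
    sandwich φ hφ h p q =
      q.sum fun b w => w • gnsBiAct φ hφ (1, b * h⁻¹) (gnsMap φ hφ p) := by
  induction p using Finsupp.induction_linear with
  | zero => simp
  | add x y hx hy =>
    simp only [map_add, LinearMap.add_apply, hx, hy, smul_add, Finsupp.sum, Finset.sum_add_distrib]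
  | single a z =>
    rw [sandwich, Finsupp.linearCombination_single, LinearMap.smul_apply,
      Finsupp.linearCombination_apply, Finsupp.smul_sum]
    refine Finsupp.sum_congr fun b _ => ?_
    rw [gnsMap_single, map_smul, gnsBiAct_gnsDelta, smul_comm]
    congr 3
    group

theorem sandwich_eq_right (φ : Γ → ℂ) (hφ : φ ∈ traceSet Γ) (h : Γ) (p q : Γ →₀ ℂ) :
    sandwich φ hφ h p q = p.sum fun a z => z • (gnsRep φ hφ).act (a * h)
      (Finsupp.linearCombination ℂ (fun b => gnsDelta φ hφ b⁻¹) q) := by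
  rw [sandwich, Finsupp.linearCombination_apply, Finsupp.sum, LinearMap.sum_apply]
  refine Finset.sum_congr rfl fun a _ => ?_
  rw [LinearMap.smul_apply]
  congr 1
  rw [Finsupp.linearCombination_apply, Finsupp.linearCombination_apply, map_finsuppSum]
  refine Finsupp.sum_congr fun b _ => ?_
  rw [map_smul, act_gnsDelta]

/-- The `ℓ¹`-norm on the group algebra. -/
noncomputable def l1Norm {ι : Type*} (x : ι →₀ ℂ) : ℝ := x.sum fun _ z => ‖z‖

theorem l1Norm_nonneg {ι : Type*} (x : ι →₀ ℂ) : 0 ≤ l1Norm x :=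
  Finset.sum_nonneg fun _ _ => norm_nonneg _

theorem norm_finsuppSum_smul_le {ι E : Type*} [NormedAddCommGroup E] [NormedSpace ℂ E]
    (x : ι →₀ ℂ) (y : ι → E) {c : ℝ} (hy : ∀ a, ‖y a‖ = c) :
    ‖x.sum fun a z => z • y a‖ ≤ l1Norm x * c := by
  refine (norm_sum_le _ _).trans_eq ?_
  simp only [norm_smul, hy, l1Norm, Finsupp.sum, Finset.sum_mul]

theorem norm_sandwich_le_left (φ : Γ → ℂ) (hφ : φ ∈ traceSet Γ) (h : Γ) (p q : Γ →₀ ℂ) :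
    ‖sandwich φ hφ h p q‖ ≤ l1Norm q * ‖gnsMap φ hφ p‖ := by
  rw [sandwich_eq_left]
  exact norm_finsuppSum_smul_le q _ fun b => LinearIsometryEquiv.norm_map _ _

/-- The involution of the group algebra is isometric for the norm given by a trace. -/
theorem norm_linearCombination_inv_conjCoeff (φ : Γ → ℂ) (hφ : φ ∈ traceSet Γ) (q : Γ →₀ ℂ) :
    ‖Finsupp.linearCombination ℂ (fun b => gnsDelta φ hφ b⁻¹) (conjCoeff q)‖ =
      ‖gnsMap φ hφ q‖ := by
  have h1 (x y : Γ →₀ ℂ) :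
      inner ℂ (Finsupp.linearCombination ℂ (fun b => gnsDelta φ hφ b⁻¹) (conjCoeff x))
        (Finsupp.linearCombination ℂ (fun b => gnsDelta φ hφ b⁻¹) (conjCoeff y)) =
      inner ℂ (gnsMap φ hφ y) (gnsMap φ hφ x) := by
    induction x using Finsupp.induction_linear with
    | zero => simp
    | add x x' hx hx' => simp only [map_add, inner_add_left, inner_add_right, hx, hx']
    | single a z =>
      induction y using Finsupp.induction_linear with
      | zero => simp
      | add y y' hy hy' => simp only [map_add, inner_add_left, inner_add_right, hy, hy']
      | single b w =>
        simp only [conjCoeff_single, Finsupp.linearCombination_single, gnsMap_single,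
          inner_smul_left, inner_smul_right, inner_gnsDelta, Complex.conj_conj, inv_inv]
        rw [trace_mul_comm hφ a]
        ring
  rw [@norm_eq_sqrt_re_inner ℂ, h1, ← @norm_eq_sqrt_re_inner ℂ]

theorem norm_sandwich_le_right (φ : Γ → ℂ) (hφ : φ ∈ traceSet Γ) (h : Γ) (p q : Γ →₀ ℂ) :
    ‖sandwich φ hφ h p (conjCoeff q)‖ ≤ l1Norm p * ‖gnsMap φ hφ q‖ := by
  rw [sandwich_eq_right, ← norm_linearCombination_inv_conjCoeff]
  exact norm_finsuppSum_smul_le p _ fun b => LinearIsometryEquiv.norm_map _ _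

/-- The pairing of `p h q* v_φ` with `g v_φ`. -/
theorem inner_gnsDelta_sandwich (φ : Γ → ℂ) (hφ : φ ∈ traceSet Γ) (g h : Γ) (p q : Γ →₀ ℂ) :
    inner ℂ (gnsDelta φ hφ g) (sandwich φ hφ h p (conjCoeff q)) =
      inner ℂ (gnsMap φ hφ q) (gnsBiAct φ hφ (g⁻¹, h⁻¹) (gnsMap φ hφ p)) := by
  induction p using Finsupp.induction_linear with
  | zero => simp
  | add x y hx hy => simp only [map_add, LinearMap.add_apply, inner_add_right, hx, hy]
  | single a z =>
    induction q using Finsupp.induction_linear with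
    | zero => simp
    | add x y hx hy => simp only [map_add, inner_add_right, inner_add_left, hx, hy]
    | single b w =>
      simp only [conjCoeff_single, sandwich_single, gnsMap_single, map_smul, gnsBiAct_gnsDelta,
        inner_smul_left, inner_smul_right, inner_gnsDelta]
      rw [← mul_assoc g⁻¹, trace_mul_comm hφ _ b⁻¹, inv_inv, ← mul_assoc g⁻¹]
      ring

/-! ### The Casimir element of a finite-dimensional character -/

/-- Elements of the group algebra that form an orthonormal basis of a finite-dimensional GNS
representation. -/
theorem exists_gnsMap_orthonormalBasis {φ : Γ → ℂ} {hφ : φ ∈ traceSet Γ}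
    (h : IsFiniteDimTrace φ hφ) :
    ∃ (e : OrthonormalBasis (Fin (Module.finrank ℂ (gnsRep φ hφ).H)) ℂ (gnsRep φ hφ).H)
      (x : Fin (Module.finrank ℂ (gnsRep φ hφ).H) → Γ →₀ ℂ), ∀ i, gnsMap φ hφ (x i) = e i := by
  have : FiniteDimensional ℂ (gnsRep φ hφ).H := h
  let e := stdOrthonormalBasis ℂ (gnsRep φ hφ).H
  choose x hx using fun i => gnsMap_surjective h (e i)
  exact ⟨e, x, hx⟩

/-- The vector `∑ i, x i * h * (x i)* v_ψ`. If the `x i` form an orthonormal basis of the GNS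
representation of a finite-dimensional character, then `∑ i, x i ⊗ (x i)*` is its Casimir
element. -/
noncomputable def casimir {n : ℕ} (ψ : Γ → ℂ) (hψ : ψ ∈ traceSet Γ) (x : Fin n → Γ →₀ ℂ) (h : Γ) :
    (gnsRep ψ hψ).H :=
  ∑ i, sandwich ψ hψ h (x i) (conjCoeff (x i))

/-- The element `s x_i - ∑ j, u_ji x_j` of the group algebra, where `u` is the matrix of `s`. -/
noncomputable def casimirError {n : ℕ} {φ : Γ → ℂ} {hφ : φ ∈ traceSet Γ}
    (e : OrthonormalBasis (Fin n) ℂ (gnsRep φ hφ).H) (x : Fin n → Γ →₀ ℂ) (s : Γ) (i : Fin n) :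
    Γ →₀ ℂ :=
  leftMul s (x i) - ∑ j, inner ℂ (e j) ((gnsRep φ hφ).act s (e i)) • x j

section Casimir

variable {n : ℕ} {φ : Γ → ℂ} {hφ : φ ∈ traceSet Γ}
  {e : OrthonormalBasis (Fin n) ℂ (gnsRep φ hφ).H} {x : Fin n → Γ →₀ ℂ}

theorem gnsMap_casimirError (hx : ∀ i, gnsMap φ hφ (x i) = e i) (s : Γ) (i : Fin n) :
    gnsMap φ hφ (casimirError e x s i) = 0 := by
  rw [casimirError, map_sub, gnsMap_leftMul, map_sum, hx, sub_eq_zero]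
  simp only [map_smul, hx]
  exact (e.sum_repr' _).symm

/-- The Casimir vectors are almost invariant under conjugation if the `casimirError` is small; the
bound does not depend on `h`. -/
theorem norm_gnsBiAct_casimir_sub_le (ψ : Γ → ℂ) (hψ : ψ ∈ traceSet Γ) (s h : Γ) :
    ‖gnsBiAct ψ hψ (s, s) (casimir ψ hψ x h) - casimir ψ hψ x h‖ ≤
      ∑ i, (l1Norm (conjCoeff (leftMul s (x i))) +
        l1Norm (leftMul s (x i) - casimirError e x s i)) * ‖gnsMap ψ hψ (casimirError e x s i)‖ := by
  let u (j i : Fin n) : ℂ := inner ℂ (e j) ((gnsRep φ hφ).act s (e i))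
  let p (i : Fin n) := leftMul s (x i)
  let r (i : Fin n) := casimirError e x s i
  let q (i : Fin n) := p i - r i
  have hq (i : Fin n) : q i = ∑ j, u j i • x j := by
    simp only [q, r, p, u, casimirError, sub_sub_cancel]
  have hu (j k : Fin n) : ∑ i, u j i * conj (u k i) = if j = k then 1 else 0 := by
    have h1 := (e.map ((gnsRep φ hφ).act s)).sum_inner_mul_inner (e j) (e k)
    rw [orthonormal_iff_ite.1 e.orthonormal] at h1
    rw [← h1]
    refine Finset.sum_congr rfl fun i _ => ?_
    simp only [u, OrthonormalBasis.map_apply, inner_conj_symm]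
  have hE : casimir ψ hψ x h = ∑ i, sandwich ψ hψ h (q i) (conjCoeff (q i)) := by
    have h1 (i : Fin n) : sandwich ψ hψ h (q i) (conjCoeff (q i)) =
        ∑ j, ∑ k, (u j i * conj (u k i)) • sandwich ψ hψ h (x j) (conjCoeff (x k)) := by
      simp only [hq, map_sum, map_smul, map_smulₛₗ, LinearMap.sum_apply, LinearMap.smul_apply,
        Finset.smul_sum, smul_smul]
      rw [Finset.sum_comm]
      simp only [mul_comm]
    simp only [h1]
    rw [Finset.sum_comm]
    simp only [Finset.sum_comm (γ := Fin n) (s := Finset.univ) (t := Finset.univ)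
      (f := fun i k => (u _ i * conj (u k i)) • sandwich ψ hψ h (x _) (conjCoeff (x k))),
      ← Finset.sum_smul, hu]
    simp [casimir, ite_smul]
  have hdiff : gnsBiAct ψ hψ (s, s) (casimir ψ hψ x h) - casimir ψ hψ x h =
      ∑ i, (sandwich ψ hψ h (r i) (conjCoeff (p i)) + sandwich ψ hψ h (q i) (conjCoeff (r i))) := by
    nth_rewrite 2 [hE]
    rw [casimir, map_sum, ← Finset.sum_sub_distrib]
    refine Finset.sum_congr rfl fun i _ => ?_
    rw [gnsBiAct_sandwich, ← conjCoeff_leftMul]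
    simp only [q, p, map_sub, LinearMap.sub_apply]
    abel
  rw [hdiff]
  refine (norm_sum_le _ _).trans (Finset.sum_le_sum fun i _ => ?_)
  refine (norm_add_le _ _).trans ?_
  rw [add_mul]
  exact add_le_add (norm_sandwich_le_left ..) (norm_sandwich_le_right ..)

theorem eventually_norm_gnsBiAct_casimir_sub_lt (hx : ∀ i, gnsMap φ hφ (x i) = e i) (s : Γ) {ε : ℝ}
    (hε : 0 < ε) : ∀ᶠ ψ in 𝓝 φ, ∀ (hψ : ψ ∈ traceSet Γ) (h : Γ),
      ‖gnsBiAct ψ hψ (s, s) (casimir ψ hψ x h) - casimir ψ hψ x h‖ < ε := by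
  let c (i : Fin n) : ℝ :=
    l1Norm (conjCoeff (leftMul s (x i))) + l1Norm (leftMul s (x i) - casimirError e x s i)
  have hc (i : Fin n) : 0 ≤ c i := add_nonneg (l1Norm_nonneg _) (l1Norm_nonneg _)
  have hC : 0 < ∑ i, c i + 1 := by
    have := Finset.sum_nonneg fun i (_ : i ∈ Finset.univ) => hc i
    linarith
  have h1 : ∀ᶠ ψ in 𝓝 φ, ∀ i, ∀ hψ : ψ ∈ traceSet Γ,
      ‖gnsMap ψ hψ (casimirError e x s i)‖ < ε / (∑ i, c i + 1) :=
    Filter.eventually_all.2 fun i =>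
      eventually_norm_gnsMap_lt (gnsMap_casimirError hx s i) (div_pos hε hC)
  filter_upwards [h1] with ψ h2 hψ h
  calc _ ≤ ∑ i, c i * ‖gnsMap ψ hψ (casimirError e x s i)‖ :=
        norm_gnsBiAct_casimir_sub_le ψ hψ s h
    _ ≤ ∑ i, c i * (ε / (∑ i, c i + 1)) :=
        Finset.sum_le_sum fun i _ => mul_le_mul_of_nonneg_left (h2 i hψ).le (hc i)
    _ = (∑ i, c i) * (ε / (∑ i, c i + 1)) := (Finset.sum_mul ..).symm
    _ < (∑ i, c i + 1) * (ε / (∑ i, c i + 1)) := by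
        gcongr
        linarith
    _ = ε := mul_div_cancel₀ _ hC.ne'

/-- The element `∑ i, (x i)* x i` of the group algebra. -/
noncomputable def casimirDual (x : Fin n → Γ →₀ ℂ) : Γ →₀ ℂ :=
  ∑ i, (x i).sum fun b w => (x i).sum fun a z => Finsupp.single (b⁻¹ * a) (conj w * z)

theorem inner_gnsMap_casimirDual (ψ : Γ → ℂ) (hψ : ψ ∈ traceSet Γ) (x : Fin n → Γ →₀ ℂ) (g : Γ) :
    inner ℂ (gnsDelta ψ hψ g) (gnsMap ψ hψ (casimirDual x)) =
      ∑ i, inner ℂ (gnsMap ψ hψ (x i)) (gnsBiAct ψ hψ (1, g) (gnsMap ψ hψ (x i))) := by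
  simp only [casimirDual, map_sum, inner_sum]
  refine Finset.sum_congr rfl fun i _ => ?_
  simp only [gnsMap, Finsupp.linearCombination_apply, map_finsuppSum, Finsupp.sum_single_index,
    zero_smul]
  simp only [Finsupp.sum, inner_sum, sum_inner, map_smul, inner_smul_left,
    inner_smul_right, gnsBiAct_gnsDelta, inner_gnsDelta, Finset.mul_sum]
  rw [Finset.sum_comm]
  refine Finset.sum_congr rfl fun a _ => Finset.sum_congr rfl fun b _ => ?_
  rw [one_mul, trace_mul_comm hψ g⁻¹, mul_assoc b⁻¹]
  ring

/-- In the GNS representation of a character of dimension `n`, the central element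
`∑ i, (x i)* x i` is equal to the scalar `n`. -/
theorem gnsMap_casimirDual (hφ' : φ ∈ charSet Γ) (hx : ∀ i, gnsMap φ hφ (x i) = e i) :
    gnsMap φ hφ (casimirDual x - Finsupp.single 1 (n : ℂ)) = 0 := by
  let T (g : Γ) : (gnsRep φ hφ).H →ₗ[ℂ] (gnsRep φ hφ).H :=
    (gnsBiAct φ hφ (1, g)).toLinearEquiv.toLinearMap
  have hT (g : Γ) : inner ℂ (gnsDelta φ hφ g) (gnsMap φ hφ (casimirDual x)) =
      LinearMap.trace ℂ _ (T g) := by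
    rw [inner_gnsMap_casimirDual, LinearMap.trace_eq_sum_inner _ e]
    simp only [hx]
    rfl
  have hTmul (g h : Γ) : T (g * h) = T g * T h := by
    ext y
    exact (congrArg (gnsBiAct φ hφ · y) (by simp)).trans (gnsBiAct_mul φ hφ (1, g) (1, h) y)
  have hinv (s : Γ) : gnsBiAct φ hφ (s, s) (gnsMap φ hφ (casimirDual x)) =
      gnsMap φ hφ (casimirDual x) := by
    rw [← sub_eq_zero]
    refine UnitaryRep.eq_zero_of_cyclic (gnsRep_denseRange φ hφ) fun g => ?_
    change inner ℂ _ (gnsDelta φ hφ g) = 0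
    have h1 : gnsDelta φ hφ g = gnsBiAct φ hφ (s, s) (gnsDelta φ hφ (s⁻¹ * g * s)) := by
      rw [gnsBiAct_gnsDelta]; congr 1; group
    rw [inner_sub_left]
    nth_rewrite 1 [h1]
    rw [LinearIsometryEquiv.inner_map_map, sub_eq_zero, ← inner_conj_symm, hT, ← inner_conj_symm,
      hT, hTmul, LinearMap.trace_mul_comm, ← hTmul, mul_inv_cancel_left]
  have h1 := eq_smul_gnsVec_of_conj_invariant hφ' hφ hinv
  rw [← gnsDelta_one, hT 1] at h1
  have h2 : T 1 = LinearMap.id := by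
    ext y
    exact congrArg (fun f => f y) (map_one (gnsBiAct φ hφ))
  have : FiniteDimensional ℂ (gnsRep φ hφ).H := e.toBasis.finiteDimensional_of_finite
  rw [h2, LinearMap.trace_id, Module.finrank_eq_card_basis e.toBasis, Fintype.card_fin] at h1
  rw [map_sub, gnsMap_single, h1, sub_self]

theorem inner_gnsVec_casimir (ψ : Γ → ℂ) (hψ : ψ ∈ traceSet Γ) (x : Fin n → Γ →₀ ℂ) (h : Γ) :
    inner ℂ (gnsVec ψ hψ) (casimir ψ hψ x h) =
      inner ℂ (gnsDelta ψ hψ h⁻¹) (gnsMap ψ hψ (casimirDual x)) := by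
  rw [inner_gnsMap_casimirDual, casimir, inner_sum, ← gnsDelta_one]
  simp only [inner_gnsDelta_sandwich, inv_one]

theorem inner_gnsDelta_casimir (ψ : Γ → ℂ) (hψ : ψ ∈ traceSet Γ) (x : Fin n → Γ →₀ ℂ) (h : Γ) :
    inner ℂ (gnsDelta ψ hψ h) (casimir ψ hψ x h) =
      ∑ i, inner ℂ (gnsMap ψ hψ (x i)) (gnsBiAct ψ hψ (h⁻¹, h⁻¹) (gnsMap ψ hψ (x i))) := by
  rw [casimir, inner_sum]
  simp only [inner_gnsDelta_sandwich]

/-- For the characters `ψ` near `φ` with `π_ψ ∈ R`, the function `n |ψ|²` is uniformly close to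
the sum of the coefficients of the conjugation representation at the vectors `x i v_ψ`. The
spectral gap makes the almost invariant Casimir vectors almost scalar. -/
theorem eventually_norm_sum_coeff_sub_le {R : Set (UnitaryRep Γ)} (hR : IsHereditary R)
    (hT : HasPropertyTRel R) (hφ' : φ ∈ charSet Γ) (hx : ∀ i, gnsMap φ hφ (x i) = e i) {ε : ℝ}
    (hε : 0 < ε) : ∀ᶠ ψ in 𝓝 φ, ∀ (hψ : ψ ∈ traceSet Γ), ψ ∈ charSet Γ → gnsRep ψ hψ ∈ R → ∀ h : Γ,
      ‖∑ i, inner ℂ (gnsMap ψ hψ (x i)) (gnsBiAct ψ hψ (h, h) (gnsMap ψ hψ (x i))) -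
        ((n * ‖ψ h‖ ^ 2 : ℝ) : ℂ)‖ ≤ ε := by
  obtain ⟨Q, c, hc, H⟩ := hT.exists_norm_sub_proj_le
  have hε' : 0 < ε / (2 * c) := by positivity
  have h1 := (Filter.eventually_all_finset Q).2 fun s _ =>
    eventually_norm_gnsBiAct_casimir_sub_lt hx s hε'
  have h2 := eventually_norm_gnsMap_lt (gnsMap_casimirDual hφ' hx) (half_pos hε)
  filter_upwards [h1, h2] with ψ h1 h2 hψ hψ' hψR h
  let v := gnsVec ψ hψ
  let E := casimir ψ hψ x h⁻¹
  obtain ⟨z, hzinv, hzv, hEz⟩ : ∃ z : (gnsRep ψ hψ).H, (∀ s, gnsBiAct ψ hψ (s, s) z = z) ∧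
      inner ℂ v z = inner ℂ v E ∧ ‖E - z‖ ≤ c * (ε / (2 * c)) :=
    ⟨(gnsConj ψ hψ).invariants.starProjection E,
      Submodule.starProjection_apply_mem (gnsConj ψ hψ).invariants E,
      (gnsConj ψ hψ).inner_invariants_proj (gnsBiAct_diag_gnsVec ψ hψ) E,
      H _ (gnsConj_mem hR hψ hψR) E _ hε'.le fun s hs => (h1 s hs hψ h⁻¹).le⟩
  have hz := eq_smul_gnsVec_of_conj_invariant hψ' hψ hzinv
  rw [hzv] at hz
  have e1 : ∑ i, inner ℂ (gnsMap ψ hψ (x i)) (gnsBiAct ψ hψ (h, h) (gnsMap ψ hψ (x i))) =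
      inner ℂ (gnsDelta ψ hψ h⁻¹) E := by
    rw [inner_gnsDelta_casimir, inv_inv]
  have e2 : inner ℂ (gnsDelta ψ hψ h⁻¹) z = inner ℂ v E * ψ h := by
    rw [hz, inner_smul_right, ← gnsDelta_one, inner_gnsDelta, inv_inv, mul_one]
  have e3 : inner ℂ v E - n * conj (ψ h) = inner ℂ (gnsDelta ψ hψ h)
      (gnsMap ψ hψ (casimirDual x - Finsupp.single 1 (n : ℂ))) := by
    rw [inner_gnsVec_casimir, inv_inv, map_sub, inner_sub_right, gnsMap_single, inner_smul_right,
      inner_gnsDelta, mul_one, hψ.1.map_inv]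
  have e4 : ((n * ‖ψ h‖ ^ 2 : ℝ) : ℂ) = n * conj (ψ h) * ψ h := by
    rw [mul_assoc, Complex.conj_mul']
    push_cast
    rfl
  have e5 : inner ℂ (gnsDelta ψ hψ h⁻¹) E - n * conj (ψ h) * ψ h =
      inner ℂ (gnsDelta ψ hψ h⁻¹) (E - z) + (inner ℂ v E - n * conj (ψ h)) * ψ h := by
    rw [inner_sub_right, e2]
    ring
  have hψh : ‖ψ h‖ ≤ 1 := by
    have := norm_inner_le_norm (𝕜 := ℂ) (gnsDelta ψ hψ 1) (gnsDelta ψ hψ h)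
    rwa [inner_gnsDelta, norm_gnsDelta, norm_gnsDelta, inv_one, one_mul, one_mul] at this
  rw [e1, e4, e5]
  calc _ ≤ ‖inner ℂ (gnsDelta ψ hψ h⁻¹) (E - z)‖ + ‖inner ℂ v E - n * conj (ψ h)‖ * ‖ψ h‖ :=
        (norm_add_le _ _).trans_eq (by rw [norm_mul])
    _ ≤ c * (ε / (2 * c)) + ε / 2 * 1 := by
        gcongr
        · refine (norm_inner_le_norm _ _).trans ?_
          rwa [norm_gnsDelta, one_mul]
        · rw [e3]
          refine (norm_inner_le_norm _ _).trans ?_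
          rw [norm_gnsDelta, one_mul]
          exact (h2 hψ).le
    _ = ε := by field_simp; ring

/-- The GNS representations of the characters near `φ` with `π_ψ ∈ R` have the same dimension as
that of `φ`. -/
theorem eventually_finrank_gnsRep_eq {R : Set (UnitaryRep Γ)} (hR : IsHereditary R)
    (hT : HasPropertyTRel R) (hφ' : φ ∈ charSet Γ) (hx : ∀ i, gnsMap φ hφ (x i) = e i) :
    ∀ᶠ ψ in 𝓝 φ, ∀ (hψ : ψ ∈ traceSet Γ), ψ ∈ charSet Γ → gnsRep ψ hψ ∈ R →
      IsFiniteDimTrace ψ hψ ∧ Module.finrank ℂ (gnsRep ψ hψ).H = n := by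
  let ε : ℝ := 1 / (4 * (n + 1))
  have hε : 0 < ε := by positivity
  have h1 := eventually_norm_sum_coeff_sub_le hR hT hφ' hx hε
  have h2 : ∀ᶠ ψ in 𝓝 φ, 1 - ε < ∑ i, ‖groupForm ψ (Finsupp.single 1 1) (x i)‖ ^ 2 := by
    have hc : Continuous fun ψ => ∑ i, ‖groupForm ψ (Finsupp.single 1 1) (x i)‖ ^ 2 :=
      continuous_finsetSum _ fun i _ => (continuous_groupForm _ _).norm.pow 2
    refine (hc.tendsto φ).eventually (lt_mem_nhds ?_)
    simp only [← inner_gnsMap φ hφ, hx, gnsMap_single, one_smul]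
    have h3 := e.sum_sq_norm_inner_left (gnsDelta φ hφ 1)
    rw [h3, norm_gnsDelta]
    linarith
  have h3 : ∀ᶠ ψ in 𝓝 φ, (Matrix.of fun i j => groupForm ψ (x i) (x j)).det ≠ 0 := by
    have hc : Continuous fun ψ => (Matrix.of fun i j => groupForm ψ (x i) (x j)).det :=
      Continuous.matrix_det (continuous_matrix fun i j => continuous_groupForm _ _)
    refine (hc.tendsto φ).eventually_ne ?_
    have h4 : (Matrix.of fun i j => groupForm φ (x i) (x j)) = 1 := by
      ext i j
      rw [Matrix.of_apply, ← inner_gnsMap φ hφ, hx, hx, orthonormal_iff_ite.1 e.orthonormal,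
        Matrix.one_apply]
    rw [h4, Matrix.det_one]
    exact one_ne_zero
  filter_upwards [h1, h2, h3] with ψ h1 h2 h3 hψ hψ' hψR
  have hn : 0 < n := by
    rcases Nat.eq_zero_or_pos n with rfl | h
    · exfalso
      have := e.sum_sq_norm_inner_left (gnsDelta φ hφ 1)
      rw [norm_gnsDelta] at this
      simp at this
    · exact h
  have hn' : (0 : ℝ) < n := by exact_mod_cast hn
  obtain ⟨m, hm1, hm2⟩ := exists_mean_normSq hψ' hψ
  -- the mean of `|ψ|²` is almost `1 / n`: compare it with that of the conjugation coefficients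
  have hm : (1 - 2 * ε) / n ≤ m := by
    refine hm2 _ fun ι _ w h hw hw1 => ?_
    let C (s : Γ) (i : Fin n) : (gnsRep ψ hψ).H := gnsBiAct ψ hψ (s, s) (gnsMap ψ hψ (x i))
    have hC (s t : Γ) (i : Fin n) : inner ℂ (gnsMap ψ hψ (x i)) (C (s⁻¹ * t) i) =
        inner ℂ (C s i) (C t i) := by
      rw [← (gnsBiAct ψ hψ (s, s)).inner_map_map, ← gnsBiAct_mul, Prod.mk_mul_mk,
        mul_inv_cancel_left]
    have hpt (s t : Γ) : (∑ i, inner ℂ (C s i) (C t i)).re - ε ≤ n * ‖ψ (s⁻¹ * t)‖ ^ 2 := by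
      have := (Complex.abs_re_le_norm _).trans (h1 hψ hψ' hψR (s⁻¹ * t))
      rw [Complex.sub_re, Complex.ofReal_re] at this
      simp only [← hC]
      linarith [(abs_le.1 this).2]
    have hsq (i : Fin n) : ‖groupForm ψ (Finsupp.single 1 1) (x i)‖ ^ 2 ≤
        ∑ k, ∑ l, w k * w l * (inner ℂ (C (h k) i) (C (h l) i)).re := by
      have e1 : inner ℂ (gnsVec ψ hψ) (∑ k, (w k : ℂ) • C (h k) i) =
          groupForm ψ (Finsupp.single 1 1) (x i) := by
        rw [← inner_gnsMap ψ hψ, gnsMap_single, one_smul, gnsDelta_one, inner_sum]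
        have e2 (k : ι) : inner ℂ (gnsVec ψ hψ) (C (h k) i) =
            inner ℂ (gnsVec ψ hψ) (gnsMap ψ hψ (x i)) := by
          rw [← gnsBiAct_diag_gnsVec ψ hψ (h k), LinearIsometryEquiv.inner_map_map,
            gnsBiAct_diag_gnsVec]
        simp only [inner_smul_right, e2, ← Finset.sum_mul]
        rw [← Complex.ofReal_sum, hw1, Complex.ofReal_one, one_mul]
      have e3 : ∑ k, ∑ l, w k * w l * (inner ℂ (C (h k) i) (C (h l) i)).re =
          ‖∑ k, (w k : ℂ) • C (h k) i‖ ^ 2 := by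
        rw [@norm_sq_eq_re_inner ℂ]
        simp only [sum_inner, inner_sum, inner_smul_left, inner_smul_right, Complex.conj_ofReal,
          Finset.mul_sum]
        rw [Finset.sum_comm]
        simp only [map_sum]
        refine Finset.sum_congr rfl fun k _ => Finset.sum_congr rfl fun l _ => ?_
        rw [← mul_assoc, ← Complex.ofReal_mul]
        refine Eq.trans ?_ (Complex.re_ofReal_mul _ _).symm
        rw [mul_comm (w k)]
      rw [e3, ← e1]
      have := norm_inner_le_norm (𝕜 := ℂ) (gnsVec ψ hψ) (∑ k, (w k : ℂ) • C (h k) i)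
      rw [norm_gnsVec, one_mul] at this
      gcongr
    rw [div_le_iff₀ hn']
    have hww : ∑ k, ∑ l, w k * w l = 1 := by rw [← Finset.sum_mul_sum, hw1, one_mul]
    calc 1 - 2 * ε = 1 - ε - ε := by ring
      _ ≤ (∑ i, ∑ k, ∑ l, w k * w l * (inner ℂ (C (h k) i) (C (h l) i)).re) - ε := by
          have := Finset.sum_le_sum fun i (_ : i ∈ Finset.univ) => hsq i
          linarith
      _ = ∑ k, ∑ l, w k * w l * ((∑ i, inner ℂ (C (h k) i) (C (h l) i)).re - ε) := by
          simp only [mul_sub, Finset.sum_sub_distrib, ← Finset.sum_mul, hww, one_mul]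
          congr 1
          rw [Finset.sum_comm]
          refine Finset.sum_congr rfl fun k _ => ?_
          rw [Finset.sum_comm]
          refine Finset.sum_congr rfl fun l _ => ?_
          rw [Complex.re_sum, Finset.mul_sum]
      _ ≤ ∑ k, ∑ l, w k * w l * (n * ‖ψ ((h k)⁻¹ * h l)‖ ^ 2) := by
          gcongr with k _ l _
          · exact mul_nonneg (hw k) (hw l)
          · exact hpt _ _
      _ = (∑ k, ∑ l, w k * w l * ‖ψ ((h k)⁻¹ * h l)‖ ^ 2) * n := by
          simp only [Finset.sum_mul]
          exact Finset.sum_congr rfl fun k _ => Finset.sum_congr rfl fun l _ => by ring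
  -- `n + 1` orthonormal vectors would contradict `hm`, because `(n + 1) (1 - 2 ε) > n`
  have hrank : Module.rank ℂ (LinearMap.range (gnsMap ψ hψ)) ≤ n := by
    refine rank_le fun s hs => ?_
    by_contra! hlt
    let f (i : Fin s.card) : LinearMap.range (gnsMap ψ hψ) := (s.equivFin.symm i).1
    have hf : LinearIndependent ℂ f :=
      hs.comp _ s.equivFin.symm.injective
    have ho := InnerProductSpace.gramSchmidtNormed_orthonormal hf
    choose y hy using fun j => (InnerProductSpace.gramSchmidtNormed ℂ f j).2
    have ho' : Orthonormal ℂ fun j => gnsMap ψ hψ (y j) := by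
      simp only [hy]
      exact ho.comp_linearIsometry (LinearMap.range (gnsMap ψ hψ)).subtypeₗᵢ
    have h4 := hm1 s.card y ho'
    rw [div_le_iff₀ hn'] at hm
    have h5 : (n : ℝ) + 1 ≤ s.card := by exact_mod_cast hlt
    have h6 : 2 * ε * (n + 1) = 1 / 2 := by
      simp only [ε]
      field_simp
      norm_num
    have h7 : 2 * ε ≤ 1 / 2 := by nlinarith
    have hm0 : 0 < m := by
      by_contra! hle
      nlinarith [mul_nonneg hn'.le (neg_nonneg.2 hle)]
    nlinarith [mul_le_mul_of_nonneg_right h5 hm0.le]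
  have hfr : FiniteDimensional ℂ (LinearMap.range (gnsMap ψ hψ)) :=
    Module.rank_lt_aleph0_iff.1 (hrank.trans_lt (Cardinal.natCast_lt_aleph0))
  have htop : LinearMap.range (gnsMap ψ hψ) = ⊤ := by
    have h4 : IsClosed ((LinearMap.range (gnsMap ψ hψ) : Submodule ℂ _) : Set (gnsRep ψ hψ).H) :=
      Submodule.closed_of_finiteDimensional _
    have h5 := (gnsMap_denseRange ψ hψ).closure_range
    rw [← LinearMap.coe_range, h4.closure_eq] at h5
    exact SetLike.coe_injective h5
  let L := LinearEquiv.ofTop _ htop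
  have hfin : FiniteDimensional ℂ (gnsRep ψ hψ).H := Module.Finite.equiv L
  refine ⟨hfin, le_antisymm ?_ ?_⟩
  · rw [← L.finrank_eq]
    exact Module.finrank_le_of_rank_le hrank
  · have hli : LinearIndependent ℂ fun i => gnsMap ψ hψ (x i) := by
      rw [Fintype.linearIndependent_iff]
      intro c hc
      refine congrFun (Matrix.eq_zero_of_mulVec_eq_zero h3 ?_)
      ext i
      simp only [Matrix.mulVec, dotProduct, Matrix.of_apply, ← inner_gnsMap ψ hψ]
      have h4 := congrArg (inner ℂ (gnsMap ψ hψ (x i))) hc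
      rw [inner_sum, inner_zero_right] at h4
      simp only [inner_smul_right, mul_comm (c _)] at h4
      exact h4
    simpa using hli.fintype_card_le_finrank

end Casimir

/-! ### Finite-dimensional characters as normalized traces of irreducible unitary matrices -/

open scoped MonoidAlgebra in
/-- **Burnside's theorem** for group representations: the operators of an irreducible
finite-dimensional representation span the endomorphism algebra. -/
theorem Representation.span_range_eq_top {V : Type*} [AddCommGroup V] [Module ℂ V]
    [FiniteDimensional ℂ V] [Nontrivial V] (ρ : Representation ℂ Γ V)
    (h : ∀ W : Submodule ℂ V, (∀ g, ∀ w ∈ W, ρ g w ∈ W) → W = ⊥ ∨ W = ⊤) :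
    Submodule.span ℂ (Set.range ρ) = ⊤ := by
  have hirr : IsSimpleOrder (Subrepresentation ρ) :=
    { exists_pair_ne := ⟨⊥, ⊤, fun hbt =>
        bot_ne_top (α := Submodule ℂ V) (congrArg Subrepresentation.toSubmodule hbt)⟩
      eq_bot_or_eq_top := fun σ => (h σ.toSubmodule fun g w hw => σ.apply_mem_toSubmodule g hw).imp
        (fun h => Subrepresentation.toSubmodule_injective h)
        (fun h => Subrepresentation.toSubmodule_injective h) }
  have hs : IsSimpleModule ℂ[Γ] ρ.asModule :=
    (irreducible_iff_isSimpleModule_asModule ρ).1 hirr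
  have : FiniteDimensional ℂ ρ.asModule := Module.Finite.equiv ρ.asModuleEquiv.symm
  -- by Schur's lemma every linear map commutes with the endomorphisms of the simple module, which
  -- are scalars, so that the density theorem applies to it
  have hschur := IsSimpleModule.algebraMap_end_bijective_of_isAlgClosed ℂ (A := ℂ[Γ])
    (V := ρ.asModule)
  have hmem (r : ℂ[Γ]) : ρ.asAlgebraHom r ∈ Submodule.span ℂ (Set.range ρ) := by
    induction r using MonoidAlgebra.induction_linear with
    | zero => rw [map_zero]; exact Submodule.zero_mem _
    | add x y hx hy => rw [map_add]; exact Submodule.add_mem _ hx hy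
    | single g z =>
      rw [Representation.asAlgebraHom_single]
      exact Submodule.smul_mem _ _ (Submodule.subset_span ⟨g, rfl⟩)
  rw [eq_top_iff]
  intro f _
  let f' : Module.End (Module.End ℂ[Γ] ρ.asModule) ρ.asModule :=
    { toFun := fun m => ρ.asModuleEquiv.symm (f (ρ.asModuleEquiv m))
      map_add' := fun x y => by simp only [map_add]
      map_smul' := fun a m => by
        obtain ⟨c, rfl⟩ := hschur.2 a
        simp }
  let b := Module.finBasis ℂ V
  classical
  obtain ⟨r, hr⟩ := jacobson_density f' (Finset.univ.image fun i => ρ.asModuleEquiv.symm (b i))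
  have hf : f = ρ.asAlgebraHom r := by
    refine b.ext fun i => ?_
    have h1 := hr (ρ.asModuleEquiv.symm (b i)) (Finset.mem_image_of_mem _ (Finset.mem_univ i))
    have h2 := congrArg ρ.asModuleEquiv h1
    rw [Representation.asModuleEquiv_map_smul] at h2
    simpa [f'] using h2
  rw [hf]
  exact hmem r

/-- The class function `Tr σ` on a subrepresentation `σ` of the GNS representation of a character
is a multiple of the character. -/
theorem sum_inner_act_eq {ι : Type*} [Fintype ι] {ψ : Γ → ℂ} (hψ : ψ ∈ charSet Γ)
    {hψ' : ψ ∈ traceSet Γ} (hfd : IsFiniteDimTrace ψ hψ') (W : Submodule ℂ (gnsRep ψ hψ').H)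
    (b : OrthonormalBasis ι ℂ W) (hW : ∀ g, ∀ w ∈ W, (gnsRep ψ hψ').act g w ∈ W) (g : Γ) :
    ∑ k, inner ℂ (b k : (gnsRep ψ hψ').H) ((gnsRep ψ hψ').act g (b k)) = Fintype.card ι * ψ g := by
  let T (g : Γ) : W →ₗ[ℂ] W :=
    ((gnsRep ψ hψ').act g).toLinearEquiv.toLinearMap.restrict (hW g)
  have hTmul (g h : Γ) : T (g * h) = T g * T h := by
    ext w
    exact (gnsRep ψ hψ').act_mul_apply g h w
  have hT (g : Γ) : ∑ k, inner ℂ (b k : (gnsRep ψ hψ').H) ((gnsRep ψ hψ').act g (b k)) =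
      LinearMap.trace ℂ W (T g) := by
    rw [LinearMap.trace_eq_sum_inner _ b]
    rfl
  choose y hy using fun k => gnsMap_surjective hfd (b k : (gnsRep ψ hψ').H)
  have h1 := eq_mul_of_bounded hψ (f := fun g => LinearMap.trace ℂ W (T g))
    (C := ∑ k, l1Norm (y k) ^ 2) (fun x γ => by
      rw [hTmul, LinearMap.trace_mul_comm, ← hTmul, mul_inv_cancel_left])
    (fun n γ α => by
      have h2 : ∑ i, ∑ j, α i * conj (α j) * LinearMap.trace ℂ W (T ((γ j)⁻¹ * γ i)) =
          ((∑ k, ‖∑ i, α i • (gnsRep ψ hψ').act (γ i) (b k)‖ ^ 2 : ℝ) : ℂ) := by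
        have h3 (k : ι) : ((‖∑ i, α i • (gnsRep ψ hψ').act (γ i) (b k)‖ ^ 2 : ℝ) : ℂ) =
            ∑ i, ∑ j, α i * conj (α j) *
              inner ℂ (b k : (gnsRep ψ hψ').H) ((gnsRep ψ hψ').act ((γ j)⁻¹ * γ i) (b k)) := by
          have := inner_self_eq_norm_sq_to_K (𝕜 := ℂ)
            (∑ i, α i • (gnsRep ψ hψ').act (γ i) (b k : (gnsRep ψ hψ').H))
          rw [Complex.ofReal_pow]
          refine this.symm.trans ?_
          simp only [sum_inner, inner_sum, inner_smul_left, inner_smul_right,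
            UnitaryRep.inner_act_act', Finset.mul_sum, mul_assoc]
        simp only [← hT, Finset.mul_sum, Complex.ofReal_sum, h3]
        exact (Finset.sum_congr rfl fun i _ => Finset.sum_comm).trans Finset.sum_comm
      rw [h2, Complex.norm_real, Real.norm_of_nonneg (by positivity), Finset.sum_mul]
      refine Finset.sum_le_sum fun k _ => ?_
      rw [← mul_pow]
      gcongr
      -- right multiplication by `y k` maps `v_ψ` to `b k` and commutes with the left action
      have h4 : ∑ i, α i • (gnsRep ψ hψ').act (γ i) (b k) = (y k).sum fun a z =>
          z • gnsBiAct ψ hψ' (1, a⁻¹) (∑ i, α i • gnsDelta ψ hψ' (γ i)) := by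
        rw [← hy k, gnsMap, Finsupp.linearCombination_apply]
        simp only [Finsupp.sum, map_sum, map_smul, act_gnsDelta, gnsBiAct_gnsDelta, one_mul,
          inv_inv, Finset.smul_sum, smul_comm (α _)]
        rw [Finset.sum_comm]
      rw [h4]
      exact norm_finsuppSum_smul_le _ _ fun a => LinearIsometryEquiv.norm_map _ _) g
  have h5 : T 1 = LinearMap.id := by
    ext w
    exact (gnsRep ψ hψ').act_one_apply w
  have : FiniteDimensional ℂ W := b.toBasis.finiteDimensional_of_finite
  rw [hT, h1, h5, LinearMap.trace_id, Module.finrank_eq_card_basis b.toBasis]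

/-- A finite-dimensional character is the normalized trace of an irreducible representation by
unitary matrices. (The index type is lifted to the universe of `Γ`, in which the spaces of unitary
representations have to lie.) -/
theorem exists_matrix_representation {ψ : Γ → ℂ} (hψ : ψ ∈ charSet Γ) {hψ' : ψ ∈ traceSet Γ}
    (hfd : IsFiniteDimTrace ψ hψ') :
    ∃ (d : ℕ) (u : Γ →* Matrix (ULift.{u} (Fin d)) (ULift.{u} (Fin d)) ℂ), 0 < d ∧
      (∀ g, (u g).conjTranspose = u g⁻¹) ∧ Submodule.span ℂ (Set.range u) = ⊤ ∧
      ∀ g, (u g).trace = d * ψ g := by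
  have : FiniteDimensional ℂ (gnsRep ψ hψ').H := hfd
  let π := gnsRep ψ hψ'
  -- a minimal non-zero invariant subspace is irreducible
  let S : Set (Submodule ℂ π.H) := {W | W ≠ ⊥ ∧ ∀ g, ∀ w ∈ W, π.act g w ∈ W}
  have hS : S.Nonempty := by
    refine ⟨⊤, ?_, fun _ _ _ => Submodule.mem_top⟩
    intro h
    have h1 : gnsVec ψ hψ' ∈ (⊤ : Submodule ℂ π.H) := Submodule.mem_top
    rw [h, Submodule.mem_bot] at h1
    have := norm_gnsVec ψ hψ'
    rw [h1, norm_zero] at this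
    exact zero_ne_one this
  obtain ⟨W, ⟨hW0, hW⟩, hmin⟩ := WellFounded.has_min wellFounded_lt S hS
  have hnt : Nontrivial W := Submodule.nontrivial_iff_ne_bot.2 hW0
  let ρ : Representation ℂ Γ W :=
    { toFun := fun g => (π.act g).toLinearEquiv.toLinearMap.restrict (hW g)
      map_one' := by
        ext w
        exact π.act_one_apply w
      map_mul' := fun g h => by
        ext w
        exact π.act_mul_apply g h w }
  have hspan : Submodule.span ℂ (Set.range ρ) = ⊤ := by
    refine ρ.span_range_eq_top fun W' hW' => ?_
    by_contra! hne
    have h1 : W'.map W.subtype ∈ S := by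
      refine ⟨fun h => hne.1 (Submodule.map_injective_of_injective W.injective_subtype ?_), ?_⟩
      · rw [h, Submodule.map_bot]
      rintro g _ ⟨w, hw, rfl⟩
      exact ⟨ρ g w, hW' g w hw, rfl⟩
    refine hmin _ h1 (lt_of_le_of_ne (Submodule.map_subtype_le W W') fun h => hne.2 ?_)
    rw [eq_top_iff]
    intro w _
    have h2 : (w : π.H) ∈ W'.map W.subtype := h.ge w.2
    obtain ⟨w', hw', h3⟩ := h2
    rwa [← Subtype.ext h3]
  let d := Module.finrank ℂ W
  let b : OrthonormalBasis (ULift.{u} (Fin d)) ℂ W :=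
    (stdOrthonormalBasis ℂ W).reindex Equiv.ulift.symm
  let u : Γ →* Matrix (ULift.{u} (Fin d)) (ULift.{u} (Fin d)) ℂ :=
    ((LinearMap.toMatrixAlgEquiv b.toBasis : _ →* _)).comp ρ
  have hu (g : Γ) (i j : ULift.{u} (Fin d)) :
      u g i j = inner ℂ (b i : π.H) (π.act g (b j)) := by
    change LinearMap.toMatrixAlgEquiv b.toBasis (ρ g) i j = _
    rw [LinearMap.toMatrixAlgEquiv_apply, b.coe_toBasis, b.coe_toBasis_repr_apply,
      b.repr_apply_apply]
    rfl
  refine ⟨d, u, Module.finrank_pos, fun g => ?_, ?_, fun g => ?_⟩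
  · ext i j
    rw [Matrix.conjTranspose_apply, hu, hu]
    change conj _ = _
    rw [inner_conj_symm, π.inner_act_left]
  · have h1 : Set.range u = (LinearMap.toMatrixAlgEquiv b.toBasis).toLinearMap '' Set.range ρ := by
      rw [← Set.range_comp]
      rfl
    rw [h1, Submodule.span_image, hspan, Submodule.map_top, LinearMap.range_eq_top]
    exact (LinearMap.toMatrixAlgEquiv b.toBasis).surjective
  · have h1 := sum_inner_act_eq hψ hfd W b hW g
    rw [Matrix.trace]
    simp only [Matrix.diag_apply, hu]
    rw [h1, Fintype.card_ulift, Fintype.card_fin]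

/-! ### The two-sided action on matrices -/

section MatrixRep

variable {ι : Type u} [Fintype ι]

/-- Matrices as vectors of the Hilbert space with the Hilbert–Schmidt inner product. -/
noncomputable def matVec : Matrix ι ι ℂ ≃ₗ[ℂ] EuclideanSpace ℂ (ι × ι) :=
  (LinearEquiv.curry ℂ ℂ ι ι).symm ≪≫ₗ (WithLp.linearEquiv 2 ℂ (ι × ι → ℂ)).symm

theorem inner_matVec (M N : Matrix ι ι ℂ) :
    inner ℂ (matVec M) (matVec N) = (M.conjTranspose * N).trace := by
  rw [PiLp.inner_apply, Fintype.sum_prod_type_right]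
  simp only [Matrix.trace, Matrix.diag_apply, Matrix.mul_apply, Matrix.conjTranspose_apply]
  refine Finset.sum_congr rfl fun i _ => Finset.sum_congr rfl fun j _ => ?_
  exact mul_comm _ _

variable [DecidableEq ι]

/-- The unitary action `X ↦ u(g) X u'(h)⁻¹` of `Γ × Γ` on matrices. -/
noncomputable def biMatrixAct (u u' : Γ →* Matrix ι ι ℂ)
    (hu : ∀ g, (u g).conjTranspose = u g⁻¹) (hu' : ∀ g, (u' g).conjTranspose = u' g⁻¹) :
    Γ × Γ →* (EuclideanSpace ℂ (ι × ι) ≃ₗᵢ[ℂ] EuclideanSpace ℂ (ι × ι)) where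
  toFun g := LinearEquiv.isometryOfInner
    (matVec.symm ≪≫ₗ
      { toFun := fun X => u g.1 * X * u' g.2⁻¹
        map_add' := fun X Y => by rw [mul_add, add_mul]
        map_smul' := fun c X => by rw [Matrix.mul_smul, Matrix.smul_mul]; rfl
        invFun := fun X => u g.1⁻¹ * X * u' g.2
        left_inv := fun X => by
          simp only [← mul_assoc, ← map_mul, inv_mul_cancel, map_one, one_mul]
          rw [mul_assoc, ← map_mul, inv_mul_cancel, map_one, mul_one]
        right_inv := fun X => by
          simp only [← mul_assoc, ← map_mul, mul_inv_cancel, map_one, one_mul]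
          rw [mul_assoc, ← map_mul, mul_inv_cancel, map_one, mul_one] } ≪≫ₗ matVec)
    fun v w => by
      obtain ⟨X, rfl⟩ := matVec.surjective v
      obtain ⟨Y, rfl⟩ := matVec.surjective w
      simp only [LinearEquiv.trans_apply, LinearEquiv.symm_apply_apply, LinearEquiv.coe_mk,
        LinearMap.coe_mk, AddHom.coe_mk, inner_matVec, Matrix.conjTranspose_mul, hu, hu', inv_inv]
      rw [Matrix.trace_mul_comm]
      simp only [mul_assoc]
      rw [← mul_assoc (u' g.2⁻¹), ← map_mul, inv_mul_cancel, map_one, one_mul,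
        Matrix.trace_mul_comm]
      simp only [mul_assoc]
      rw [← map_mul, inv_mul_cancel, map_one, mul_one, Matrix.trace_mul_comm]
  map_one' := by
    ext v
    obtain ⟨X, rfl⟩ := matVec.surjective v
    simp
  map_mul' g h := by
    ext v
    obtain ⟨X, rfl⟩ := matVec.surjective v
    simp [mul_assoc]

variable (u u' : Γ →* Matrix ι ι ℂ)
  (hu : ∀ g, (u g).conjTranspose = u g⁻¹) (hu' : ∀ g, (u' g).conjTranspose = u' g⁻¹)

theorem biMatrixAct_matVec (g : Γ × Γ) (X : Matrix ι ι ℂ) :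
    biMatrixAct u u' hu hu' g (matVec X) = matVec (u g.1 * X * u' g.2⁻¹) := by
  simp [biMatrixAct]

/-- The unitary representation `X ↦ u(g) X u'(h)⁻¹` of `Γ × Γ` on matrices. -/
noncomputable def biMatrixRep : UnitaryRep (Γ × Γ) where
  H := EuclideanSpace ℂ (ι × ι)
  act := biMatrixAct u u' hu hu'

/-- The linear extension of a matrix representation to the group algebra. -/
noncomputable def matrixEval : (Γ →₀ ℂ) →ₗ[ℂ] Matrix ι ι ℂ := Finsupp.linearCombination ℂ u

theorem matrixEval_single (a : Γ) (z : ℂ) : matrixEval u (Finsupp.single a z) = z • u a := by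
  simp [matrixEval]

variable {u u'}

theorem matrixEval_leftMul (s : Γ) (x : Γ →₀ ℂ) :
    matrixEval u (leftMul s x) = u s * matrixEval u x := by
  induction x using Finsupp.induction_linear with
  | zero => simp
  | add x y hx hy => simp only [map_add, hx, hy, mul_add]
  | single a z =>
    rw [leftMul_single, matrixEval_single, matrixEval_single, map_mul, Matrix.mul_smul]

theorem trace_conjTranspose_matrixEval_mul {ψ : Γ → ℂ} {d : ℕ}
    (hu : ∀ g, (u g).conjTranspose = u g⁻¹) (ht : ∀ g, (u g).trace = d * ψ g) (x y : Γ →₀ ℂ) :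
    ((matrixEval u x).conjTranspose * matrixEval u y).trace = d * groupForm ψ x y := by
  simp only [matrixEval, Finsupp.linearCombination_apply, groupForm, Finsupp.sum,
    Matrix.conjTranspose_sum, Matrix.conjTranspose_smul, hu, Finset.sum_mul, Finset.mul_sum,
    Matrix.trace_sum, Matrix.smul_mul, Matrix.mul_smul, Matrix.trace_smul, ← map_mul, ht,
    smul_eq_mul]
  rw [Finset.sum_comm]
  refine Finset.sum_congr rfl fun a _ => Finset.sum_congr rfl fun b _ => ?_
  rw [Complex.star_def]
  ring

theorem matrixEval_surjective (h : Submodule.span ℂ (Set.range u) = ⊤) :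
    Function.Surjective (matrixEval u) := by
  rw [← LinearMap.range_eq_top, matrixEval, Finsupp.range_linearCombination, h]

/-- The sum of `E* M E` over the matrix units `E` is the scalar matrix `tr M`. -/
theorem sum_single_conjTranspose_mul_mul_single (M : Matrix ι ι ℂ) :
    ∑ e : ι × ι, (Matrix.single e.1 e.2 (1 : ℂ)).conjTranspose * M * Matrix.single e.1 e.2 1 =
      M.trace • (1 : Matrix ι ι ℂ) := by
  rw [Fintype.sum_prod_type]
  simp only [Matrix.conjTranspose_single, star_one, Matrix.single_mul_mul_single, one_mul, mul_one]
  ext i j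
  simp [Matrix.sum_apply, Matrix.single_apply, Matrix.one_apply, Matrix.trace]
  split_ifs with h
  · subst h
    simp
  · exact Finset.sum_eq_zero fun k _ => Finset.sum_eq_zero fun l _ =>
      if_neg fun hl => h (hl.1.symm.trans hl.2)

/-- Two irreducible unitary matrix representations with a non-zero intertwiner have the same
trace. -/
theorem trace_eq_of_intertwiner {X : Matrix ι ι ℂ} (hX : X ≠ 0)
    (hu : ∀ g, (u g).conjTranspose = u g⁻¹) (hu' : ∀ g, (u' g).conjTranspose = u' g⁻¹)
    (hspan : Submodule.span ℂ (Set.range u') = ⊤) (h : ∀ g, u g * X = X * u' g) (g : Γ) :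
    (u g).trace = (u' g).trace := by
  -- `X* X` commutes with all matrices, and so it is a scalar
  have h1 (M : Matrix ι ι ℂ) : X.conjTranspose * X * M = M * (X.conjTranspose * X) := by
    have hM : M ∈ Submodule.span ℂ (Set.range u') := hspan ▸ Submodule.mem_top
    induction hM using Submodule.span_induction with
    | mem _ hM =>
      obtain ⟨g, rfl⟩ := hM
      have h2 := congrArg Matrix.conjTranspose (h g⁻¹)
      rw [Matrix.conjTranspose_mul, Matrix.conjTranspose_mul, hu, hu', inv_inv] at h2
      rw [mul_assoc, ← h, ← mul_assoc, h2, mul_assoc]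
    | zero => simp
    | add M N _ _ hM hN => rw [mul_add, add_mul, hM, hN]
    | smul c M _ hM => rw [Matrix.mul_smul, Matrix.smul_mul, hM]
  obtain ⟨c, hc⟩ := Matrix.mem_range_scalar_iff_commute_single'.2 fun i j => (h1 _).symm
  have hc' : X.conjTranspose * X = c • 1 := by
    rw [← hc, Matrix.scalar_apply, Matrix.smul_one_eq_diagonal]
  have hc0 : c ≠ 0 := by
    rintro rfl
    rw [zero_smul, Matrix.conjTranspose_mul_self_eq_zero] at hc'
    exact hX hc'
  have h2 : (c⁻¹ • X.conjTranspose) * X = 1 := by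
    rw [Matrix.smul_mul, hc', smul_smul, inv_mul_cancel₀ hc0, one_smul]
  have h3 := mul_eq_one_comm.1 h2
  rw [← one_mul (u' g), ← h2, mul_assoc, ← h, ← mul_assoc, Matrix.trace_mul_comm, ← mul_assoc, h3,
    one_mul]

theorem exists_conj_mul_self_mul_eq_one {d : ℕ} (hd : 0 < d) :
    ∃ c : ℂ, c ≠ 0 ∧ conj c * c * d = 1 := by
  have hc : conj (((√d)⁻¹ : ℝ) : ℂ) * ((√d)⁻¹ : ℝ) * d = 1 := by
    rw [Complex.conj_ofReal, ← Complex.ofReal_mul, ← mul_inv, Real.mul_self_sqrt d.cast_nonneg]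
    push_cast
    exact inv_mul_cancel₀ (by exact_mod_cast hd.ne')
  refine ⟨_, fun h => ?_, hc⟩
  rw [h, mul_zero, zero_mul] at hc
  exact zero_ne_one hc

theorem inner_matVec_smul_one {d : ℕ} {c z : ℂ} (hc : conj c * c * d = 1) {M : Matrix ι ι ℂ}
    (hM : M.trace = d * z) : inner ℂ (matVec (c • (1 : Matrix ι ι ℂ))) (matVec (c • M)) = z := by
  rw [inner_matVec, Matrix.conjTranspose_smul, Matrix.conjTranspose_one, Matrix.smul_mul,
    Matrix.mul_smul, one_mul, Matrix.trace_smul, Matrix.trace_smul, hM, smul_eq_mul, smul_eq_mul,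
    Complex.star_def]
  linear_combination z * hc

section NormalizedTrace

variable {d : ℕ} {ψ : Γ → ℂ}

/-- Multiplication by `u(g)` from the left is the GNS representation of the normalized trace of
`u`: a multiple of the identity matrix corresponds to the GNS vector. -/
theorem exists_isometry_biMatrixRep_inl (hd : 0 < d) (hψ : ψ ∈ traceSet Γ)
    (hspan : Submodule.span ℂ (Set.range u) = ⊤) (ht : ∀ g, (u g).trace = d * ψ g) :
    ∃ V : ((biMatrixRep u u' hu hu').comap (MonoidHom.inl Γ Γ)).H →ₗᵢ[ℂ] (gnsRep ψ hψ).H,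
      (∀ γ x, V (((biMatrixRep u u' hu hu').comap (MonoidHom.inl Γ Γ)).act γ x) =
        (gnsRep ψ hψ).act γ (V x)) ∧
      LinearMap.range (gnsMap ψ hψ) ≤ LinearMap.range V.toLinearMap := by
  obtain ⟨c, hc0, hc⟩ := exists_conj_mul_self_mul_eq_one hd
  let ρ := (biMatrixRep u u' hu hu').comap (MonoidHom.inl Γ Γ)
  have hact (g : Γ) (X : Matrix ι ι ℂ) : ρ.act g (matVec X : EuclideanSpace ℂ (ι × ι)) =
      (matVec (u g * X) : EuclideanSpace ℂ (ι × ι)) := by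
    refine (biMatrixAct_matVec u u' hu hu' (g, 1) X).trans ?_
    rw [inv_one, map_one, mul_one]
  let ξ : ρ.H := (matVec (c • (1 : Matrix ι ι ℂ)) : EuclideanSpace ℂ (ι × ι))
  have horb (x : Γ →₀ ℂ) : ρ.orbitMap ξ x =
      (matVec (c • matrixEval u x) : EuclideanSpace ℂ (ι × ι)) := by
    induction x using Finsupp.induction_linear with
    | zero => simp; rfl
    | add x y hx hy => rw [map_add, hx, hy, map_add, smul_add, map_add]; rfl
    | single a z =>
      rw [UnitaryRep.orbitMap_single, hact, matrixEval_single, Matrix.mul_smul, mul_one, smul_comm,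
        map_smul]
      rfl
  have hdense : DenseRange (ρ.orbitMap ξ) := by
    refine Function.Surjective.denseRange fun v => ?_
    obtain ⟨X, hX⟩ := matVec.surjective v
    obtain ⟨x, hx⟩ := matrixEval_surjective hspan (c⁻¹ • X)
    refine ⟨x, ?_⟩
    rw [horb, hx, smul_smul, mul_inv_cancel₀ hc0, one_smul, hX]
  obtain ⟨V, hV, hVξ⟩ := UnitaryRep.exists_isometry_of_coeff_eq (π := gnsRep ψ hψ)
    (η := gnsVec ψ hψ) hdense fun g => by
      rw [gnsRep_coeff]
      refine (congrArg (inner ℂ (matVec (c • (1 : Matrix ι ι ℂ)))) (hact g _)).trans ?_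
      rw [Matrix.mul_smul, mul_one]
      exact inner_matVec_smul_one hc (ht g)
  refine ⟨V, hV, ?_⟩
  -- the isometry maps `x ξ` to `x v_ψ` for `x` in the group algebra
  rintro _ ⟨x, rfl⟩
  refine ⟨ρ.orbitMap ξ x, ?_⟩
  rw [UnitaryRep.orbitMap_apply, gnsMap, Finsupp.linearCombination_apply]
  refine (map_finsuppSum V.toLinearMap _ _).trans (Finsupp.sum_congr fun a _ => ?_)
  refine (map_smul V _ _).trans ?_
  rw [hV, hVξ]
  rfl

/-- Multiplication by `u'(g)⁻¹` from the right is contained in the dual of the GNS representation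
of the normalized trace of `u'`. -/
theorem isSubrep_dual_biMatrixRep_inr (hd : 0 < d) (hψ : ψ ∈ traceSet Γ)
    (hspan : Submodule.span ℂ (Set.range u') = ⊤) (ht : ∀ g, (u' g).trace = d * ψ g) :
    ((biMatrixRep u u' hu hu').comap (MonoidHom.inr Γ Γ)).IsSubrep (gnsRep ψ hψ).dual := by
  obtain ⟨c, hc0, hc⟩ := exists_conj_mul_self_mul_eq_one hd
  let ρ := (biMatrixRep u u' hu hu').comap (MonoidHom.inr Γ Γ)
  have hact (g : Γ) : ρ.act g (matVec (c • (1 : Matrix ι ι ℂ)) : EuclideanSpace ℂ (ι × ι)) =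
      (matVec (c • u' g⁻¹) : EuclideanSpace ℂ (ι × ι)) := by
    refine (biMatrixAct_matVec u u' hu hu' (1, g) _).trans ?_
    rw [map_one, one_mul, Matrix.smul_mul, one_mul]
  let ξ : ρ.H := (matVec (c • (1 : Matrix ι ι ℂ)) : EuclideanSpace ℂ (ι × ι))
  have hmem (X : Matrix ι ι ℂ) :
      (matVec (c • X) : EuclideanSpace ℂ (ι × ι)) ∈ LinearMap.range (ρ.orbitMap ξ) := by
    have hX : X ∈ Submodule.span ℂ (Set.range u') := hspan ▸ Submodule.mem_top
    induction hX using Submodule.span_induction with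
    | mem _ hX =>
      obtain ⟨g, rfl⟩ := hX
      refine ⟨Finsupp.single g⁻¹ 1, ?_⟩
      rw [UnitaryRep.orbitMap_single, one_smul, hact, inv_inv]
    | zero =>
      rw [smul_zero, map_zero]
      exact Submodule.zero_mem _
    | add X Y _ _ hX hY =>
      rw [smul_add, map_add]
      exact Submodule.add_mem _ hX hY
    | smul z X _ hX =>
      rw [smul_comm, map_smul]
      exact Submodule.smul_mem _ z hX
  refine UnitaryRep.isSubrep_dual_of_coeff_eq (ξ := ξ) (η := gnsVec ψ hψ) ?_ fun g => ?_
  · refine Function.Surjective.denseRange fun v => ?_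
    obtain ⟨X, hX⟩ := matVec.surjective v
    have h1 := hmem (c⁻¹ • X)
    rw [smul_smul, mul_inv_cancel₀ hc0, one_smul, hX] at h1
    exact h1
  · rw [gnsRep_coeff, ← hψ.1.map_inv]
    refine (congrArg (inner ℂ (matVec (c • (1 : Matrix ι ι ℂ)))) (hact g)).trans ?_
    exact inner_matVec_smul_one hc (ht g⁻¹)

/-- The GNS representation of a finite-dimensional character has dimension `d ^ 2`, where `d` is
the size of the corresponding matrices. -/
theorem finrank_gnsRep_eq_card (hd : 0 < d) (hψ : ψ ∈ traceSet Γ)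
    (hu : ∀ g, (u g).conjTranspose = u g⁻¹)
    (hspan : Submodule.span ℂ (Set.range u) = ⊤) (ht : ∀ g, (u g).trace = d * ψ g)
    (hfd : IsFiniteDimTrace ψ hψ) :
    Module.finrank ℂ (gnsRep ψ hψ).H = Fintype.card ι * Fintype.card ι := by
  obtain ⟨V, -, hV⟩ := exists_isometry_biMatrixRep_inl hu hu hd hψ hspan ht
  have h1 : Function.Surjective V.toLinearMap := by
    rw [← LinearMap.range_eq_top, eq_top_iff]
    rwa [LinearMap.range_eq_top.2 (gnsMap_surjective hfd)] at hV
  rw [← (LinearEquiv.ofBijective V.toLinearMap ⟨V.injective, h1⟩).finrank_eq]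
  refine (finrank_euclideanSpace (𝕜 := ℂ) (ι := ι × ι)).trans ?_
  rw [Fintype.card_prod]

end NormalizedTrace

/-! ### Separating the characters near a finite-dimensional one -/

/-- A function of pairs of functions on `Γ`. If the `x i` are obtained from a finite-dimensional
character `φ`, then it is the constant `1` in `s` at the pair `(φ, φ)`, and at a pair of characters
of dimension `n` it is a sum of coefficients of the diagonal action on matrices. -/
noncomputable def pairForm {n : ℕ} (x : Fin n → Γ →₀ ℂ) (s : Γ) (f f' : Γ → ℂ) : ℂ :=
  (n : ℂ)⁻¹ * ∑ i, ∑ j, groupForm f (x i) (leftMul s (x j)) *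
    conj (groupForm f' (x i) (leftMul s (x j)))

theorem continuous_pairForm {n : ℕ} (x : Fin n → Γ →₀ ℂ) (s : Γ) :
    Continuous fun p : (Γ → ℂ) × (Γ → ℂ) => pairForm x s p.1 p.2 := by
  refine continuous_const.mul
    (continuous_finsetSum _ fun i _ => continuous_finsetSum _ fun j _ => ?_)
  exact ((continuous_groupForm _ _).comp continuous_fst).mul
    (Complex.continuous_conj.comp ((continuous_groupForm _ _).comp continuous_snd))

theorem pairForm_self {n : ℕ} {φ : Γ → ℂ} {hφ : φ ∈ traceSet Γ}
    {e : OrthonormalBasis (Fin n) ℂ (gnsRep φ hφ).H} {x : Fin n → Γ →₀ ℂ}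
    (hx : ∀ i, gnsMap φ hφ (x i) = e i) (hn : n ≠ 0) (s : Γ) : pairForm x s φ φ = 1 := by
  have h1 : ∑ i, ∑ j, groupForm φ (x i) (leftMul s (x j)) *
      conj (groupForm φ (x i) (leftMul s (x j))) = n := by
    simp only [← inner_gnsMap φ hφ, gnsMap_leftMul, hx, Complex.mul_conj']
    rw [Finset.sum_comm]
    have h2 (j : Fin n) : ∑ i, (‖inner ℂ (e i) ((gnsRep φ hφ).act s (e j))‖ : ℂ) ^ 2 = 1 := by
      have := e.sum_sq_norm_inner_right ((gnsRep φ hφ).act s (e j))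
      rw [LinearIsometryEquiv.norm_map, e.norm_eq_one, one_pow] at this
      exact_mod_cast this
    simp [h2]
  rw [pairForm, h1, inv_mul_cancel₀ (Nat.cast_ne_zero.2 hn)]

/-- The functions of positive type associated to the vectors `n⁻¹ ∑ⱼ U(xⱼ) E U'(xⱼ)*`, where `E`
runs through the matrix units, add up to the form `pairForm`. -/
theorem sum_inner_biMatrixAct {d n : ℕ} {ψ ψ' : Γ → ℂ} (hn : n ≠ 0) (hnd : d * d = n)
    (ht : ∀ g, (u g).trace = d * ψ g) (ht' : ∀ g, (u' g).trace = d * ψ' g)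
    (x : Fin n → Γ →₀ ℂ) :
    ∃ η : ι × ι → EuclideanSpace ℂ (ι × ι), ∀ s,
      ∑ e, inner ℂ (η e) (biMatrixAct u u' hu hu' (s, s) (η e)) = pairForm x s ψ ψ' := by
  refine ⟨fun e => (n : ℂ)⁻¹ • matVec (∑ j, matrixEval u (x j) * Matrix.single e.1 e.2 1 *
    (matrixEval u' (x j)).conjTranspose), fun s => ?_⟩
  have h1 (i j : Fin n) : ∑ e : ι × ι, ((matrixEval u (x i) * Matrix.single e.1 e.2 1 *
        (matrixEval u' (x i)).conjTranspose).conjTranspose * (u s * (matrixEval u (x j) *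
        Matrix.single e.1 e.2 1 * (matrixEval u' (x j)).conjTranspose) * u' s⁻¹)).trace =
      n * (groupForm ψ (x i) (leftMul s (x j)) * conj (groupForm ψ' (x i) (leftMul s (x j)))) := by
    let A := (matrixEval u (x i)).conjTranspose * matrixEval u (leftMul s (x j))
    let B := (matrixEval u' (x i)).conjTranspose * matrixEval u' (leftMul s (x j))
    have h2 (E : Matrix ι ι ℂ) : ((matrixEval u (x i) * E *
        (matrixEval u' (x i)).conjTranspose).conjTranspose * (u s * (matrixEval u (x j) *
        E * (matrixEval u' (x j)).conjTranspose) * u' s⁻¹)).trace =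
        (E.conjTranspose * A * E * B.conjTranspose).trace := by
      simp only [A, B, matrixEval_leftMul, Matrix.conjTranspose_mul,
        Matrix.conjTranspose_conjTranspose, hu']
      rw [mul_assoc, Matrix.trace_mul_comm]
      simp only [mul_assoc]
    simp only [h2]
    rw [← Matrix.trace_sum, ← Finset.sum_mul, sum_single_conjTranspose_mul_mul_single,
      Matrix.smul_mul, one_mul, Matrix.trace_smul, Matrix.trace_conjTranspose,
      trace_conjTranspose_matrixEval_mul hu ht, trace_conjTranspose_matrixEval_mul hu' ht',
      ← hnd, smul_eq_mul, star_mul', Complex.star_def, map_natCast]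
    push_cast
    ring
  have h0 : (n : ℂ) ≠ 0 := Nat.cast_ne_zero.2 hn
  simp only [map_smul, inner_smul_left, inner_smul_right, biMatrixAct_matVec, inner_matVec,
    Matrix.conjTranspose_sum, Finset.sum_mul, Finset.mul_sum, Matrix.trace_sum, map_inv₀,
    map_natCast]
  conv_rhs => rw [pairForm, Finset.sum_comm, Finset.mul_sum]
  rw [Finset.sum_comm]
  refine Finset.sum_congr rfl fun i _ => ?_
  rw [Finset.sum_comm, Finset.mul_sum]
  refine Finset.sum_congr rfl fun j _ => ?_
  rw [← Finset.mul_sum, ← Finset.mul_sum, h1]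
  field_simp

/-- Two finite-dimensional characters coincide if they are given by matrices of the same size and
the diagonal action on these matrices is close to containing the trivial representation. -/
theorem eq_of_norm_pairForm_lt {R : Set (UnitaryRep Γ)} (hR : IsHereditary R) {Q : Finset Γ}
    {δ : ℝ} (hgap : ∀ π ∈ R, ∀ (m : ℕ) (η : Fin m → π.H),
      (∀ j, η j ∈ π.invariantsᗮ) → ¬ ∀ s ∈ Q, ‖1 - ∑ j, π.coeff (η j) s‖ < δ)
    {n : ℕ} {x : Fin n → Γ →₀ ℂ} {ψ ψ' : Γ → ℂ} (hψ : ψ ∈ charSet Γ) (hψ' : ψ' ∈ charSet Γ)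
    (hψR : gnsRep ψ (charSet_subset hψ) ∈ R) (hψR' : gnsRep ψ' (charSet_subset hψ') ∈ R)
    (hfd : IsFiniteDimTrace ψ (charSet_subset hψ)) (hfd' : IsFiniteDimTrace ψ' (charSet_subset hψ'))
    (hn : Module.finrank ℂ (gnsRep ψ (charSet_subset hψ)).H = n)
    (hn' : Module.finrank ℂ (gnsRep ψ' (charSet_subset hψ')).H = n)
    (h : ∀ s ∈ Q, ‖1 - pairForm x s ψ ψ'‖ < δ) : ψ = ψ' := by
  obtain ⟨d, u, hd, hu, hspan, ht⟩ := exists_matrix_representation hψ hfd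
  obtain ⟨d', u', hd', hu', hspan', ht'⟩ := exists_matrix_representation hψ' hfd'
  have h1 := finrank_gnsRep_eq_card hd _ hu hspan ht hfd
  have h2 := finrank_gnsRep_eq_card hd' _ hu' hspan' ht' hfd'
  rw [hn, Fintype.card_ulift, Fintype.card_fin] at h1
  rw [hn', Fintype.card_ulift, Fintype.card_fin] at h2
  obtain rfl : d = d' := Nat.mul_self_inj.1 (h1.symm.trans h2)
  have hn0 : n ≠ 0 := by
    rw [h1]
    positivity
  let π : UnitaryRep Γ :=
    (biMatrixRep u u' hu hu').comap ((MonoidHom.id Γ).prod (MonoidHom.id Γ))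
  have hπ : π ∈ R := by
    obtain ⟨V, hV, -⟩ := exists_isometry_biMatrixRep_inl hu hu' hd (charSet_subset hψ) hspan ht
    exact hR.diagonal_closed _ (hR.subrep_closed _ hψR _ ⟨V, hV⟩)
      (hR.subrep_closed _ (hR.dual_closed _ hψR') _
        (isSubrep_dual_biMatrixRep_inr hu hu' hd' _ hspan' ht'))
  obtain ⟨η, hη⟩ := sum_inner_biMatrixAct hu hu' hn0 h1.symm ht ht' x
  have hinv : π.invariants ≠ ⊥ := by
    intro hbot
    refine hgap π hπ _ (fun j => η ((Fintype.equivFin _).symm j)) (fun j => ?_) fun s hs => ?_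
    · rw [hbot, Submodule.bot_orthogonal_eq_top]
      exact Submodule.mem_top
    · have h3 : ∑ j, π.coeff (η ((Fintype.equivFin _).symm j)) s = pairForm x s ψ ψ' :=
        ((Fintype.equivFin _).symm.sum_comp fun e => π.coeff (η e) s).trans (hη s)
      rw [h3]
      exact h s hs
  obtain ⟨v, hv, hv0⟩ := Submodule.exists_mem_ne_zero_of_ne_bot hinv
  obtain ⟨X, hX⟩ := matVec.surjective v
  have hX0 : X ≠ 0 := by
    rintro rfl
    exact hv0 (hX.symm.trans (map_zero _))
  have hint (g : Γ) : u g * X = X * u' g := by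
    have h3 : matVec (u g * X * u' g⁻¹) = matVec X := by
      refine (biMatrixAct_matVec u u' hu hu' (g, g) X).symm.trans ?_
      rw [hX]
      exact hv g
    have h4 := matVec.injective h3
    conv_rhs => rw [← h4, mul_assoc, ← map_mul, inv_mul_cancel, map_one, mul_one]
  funext g
  have h5 := trace_eq_of_intertwiner hX0 hu hu' hspan' hint g
  rw [ht, ht'] at h5
  exact mul_left_cancel₀ (Nat.cast_ne_zero.2 hd.ne') h5

end MatrixRep

/-- The characters in the family that are near a finite-dimensional character coincide. -/
theorem exists_isOpen_subsingleton {R : Set (UnitaryRep Γ)} (hR : IsHereditary R)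
    (hT : HasPropertyTRel R) {φ : Γ → ℂ} (hφ : φ ∈ charSet Γ)
    (hfd : IsFiniteDimTrace φ (charSet_subset hφ)) :
    ∃ U : Set (Γ → ℂ), IsOpen U ∧ φ ∈ U ∧ (U ∩ charSetRel R).Subsingleton := by
  obtain ⟨e, x, hx⟩ := exists_gnsMap_orthonormalBasis hfd
  obtain ⟨Q, δ, hδ, hgap⟩ := hT.exists_gap
  have hn : Module.finrank ℂ (gnsRep φ (charSet_subset hφ)).H ≠ 0 := by
    have : FiniteDimensional ℂ (gnsRep φ (charSet_subset hφ)).H := hfd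
    have hv : gnsVec φ (charSet_subset hφ) ≠ 0 := by
      rw [← norm_ne_zero_iff, norm_gnsVec]
      exact one_ne_zero
    have : Nontrivial (gnsRep φ (charSet_subset hφ)).H := ⟨_, _, hv⟩
    exact Module.finrank_pos.ne'
  have h1 : ∀ᶠ p in 𝓝 φ ×ˢ 𝓝 φ, ∀ s ∈ Q, ‖1 - pairForm x s p.1 p.2‖ < δ := by
    rw [← nhds_prod_eq]
    refine (Filter.eventually_all_finset Q).2 fun s _ => ?_
    have hc := (continuous_const (y := (1 : ℂ))).sub (continuous_pairForm x s)
    refine (hc.norm.tendsto (φ, φ)).eventually (gt_mem_nhds ?_)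
    change ‖1 - pairForm x s φ φ‖ < δ
    rwa [pairForm_self hx hn, sub_self, norm_zero]
  obtain ⟨U, hU, h2⟩ := (Filter.eventually_prod_self_iff (r := fun f f' : Γ → ℂ =>
    ∀ s ∈ Q, ‖1 - pairForm x s f f'‖ < δ)).1 h1
  obtain ⟨W, hW, hWo, hφW⟩ := mem_nhds_iff.1
    (Filter.inter_mem hU (eventually_finrank_gnsRep_eq hR hT hφ hx))
  refine ⟨W, hWo, hφW, ?_⟩
  rintro ψ ⟨hψ, hψc, hψR⟩ ψ' ⟨hψ', hψc', hψR'⟩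
  obtain ⟨h3, h4⟩ := (hW hψ).2 _ hψc hψR
  obtain ⟨h3', h4'⟩ := (hW hψ').2 _ hψc' hψR'
  exact eq_of_norm_pairForm_lt hR hgap hψc hψc' hψR hψR' h3 h3' h4 h4'
    (h2 ψ (hW hψ).1 ψ' (hW hψ').1)

theorem isIsolatedPointOf_closure {X : Type*} [TopologicalSpace X] [T1Space X] {S U : Set X} {x : X}
    (hU : IsOpen U) (hx : x ∈ U) (hxS : x ∈ closure S) (h : (U ∩ S).Subsingleton) :
    IsIsolatedPointOf x (closure S) := by
  obtain ⟨y, hy⟩ := mem_closure_iff.1 hxS U hU hx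
  have h1 : U ∩ closure S ⊆ {y} := by
    refine hU.inter_closure.trans (closure_minimal (fun z hz => h hz hy) isClosed_singleton)
  obtain rfl : x = y := h1 ⟨hx, hxS⟩
  exact ⟨U, hU, h1.antisymm (Set.singleton_subset_iff.2 ⟨hx, hxS⟩)⟩

theorem isHereditary_univ : IsHereditary (Set.univ : Set (UnitaryRep Γ)) :=
  ⟨fun _ _ _ _ => trivial, fun _ _ => trivial, fun _ _ _ => trivial⟩

theorem charSetRel_univ : charSetRel (Set.univ : Set (UnitaryRep Γ)) = charSet Γ :=
  Set.ext fun _ => ⟨fun h => h.1, fun h => ⟨h, trivial⟩⟩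

end

theorem mainTheorem5 {Γ : Type u} [Group Γ] [Countable Γ] :
    (∀ R : Set (UnitaryRep Γ), IsHereditary R → HasPropertyTRel R →
      ∀ (φ : Γ → ℂ) (hφ : φ ∈ charSet Γ), IsFiniteDimTrace φ (charSet_subset hφ) →
        φ ∈ closure (charSetRel R) → IsIsolatedPointOf φ (closure (charSetRel R))) ∧
    (HasPropertyT Γ →
      ∀ (φ : Γ → ℂ) (hφ : φ ∈ charSet Γ), IsFiniteDimTrace φ (charSet_subset hφ) →
        IsIsolatedPointOf φ (charSet Γ)) := by
  have h1 : ∀ R : Set (UnitaryRep Γ), IsHereditary R → HasPropertyTRel R →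
      ∀ (φ : Γ → ℂ) (hφ : φ ∈ charSet Γ), IsFiniteDimTrace φ (charSet_subset hφ) →
        φ ∈ closure (charSetRel R) → IsIsolatedPointOf φ (closure (charSetRel R)) := by
    intro R hR hT φ hφ hfd hφR
    obtain ⟨U, hU, hφU, hsub⟩ := exists_isOpen_subsingleton hR hT hφ hfd
    exact isIsolatedPointOf_closure hU hφU hφR hsub
  refine ⟨h1, fun hT φ hφ hfd => ?_⟩
  have h2 := h1 Set.univ isHereditary_univ hT.hasPropertyTRel_univ φ hφ hfd
  rw [charSetRel_univ] at h2
  obtain ⟨U, hU, hUφ⟩ := h2 (subset_closure hφ)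
  refine ⟨U, hU, Set.Subset.antisymm ?_ (Set.singleton_subset_iff.2 ⟨?_, hφ⟩)⟩
  · rw [← hUφ]
    exact Set.inter_subset_inter_right U subset_closure
  · exact (hUφ.ge rfl).1
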